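/- Let $S$ be the set of integers that are sums of two integer squares, let $S(x) = S \cap [1,x]$ for real $x$, and for $n \ge 1$ let $\omega_1(n)$ denote the number of distinct prime divisors $p \equiv 1 \pmod 4$ of $n$. Then, as $x \to \infty$, $$\frac{1}{|S(x)|} \sum_{n \in S(x)} \omega_1(n) = \frac12 \log\log x + O(\log\log\log x)$$ and $$\frac{1}{|S(x)|} \sum_{n \in S(x)} \omega_1(n)^2 = \frac14 (\log\log x)^2 + O\big((\log\log x)\cdot \log\log\log x\big).$$ -/

import Mathlib

open Filter Asymptotics

/-- The set `S` of integers that are sums of two integer squares. Such integers are nonnegative,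
so `S` is taken as a set of natural numbers. -/
def sumTwoSq : Set ℕ := {n | ∃ a b : ℤ, (n : ℤ) = a ^ 2 + b ^ 2}

open Classical in
/-- `S(x) = S ∩ [1, x]`, for real `x`. -/
noncomputable def sumTwoSqUpTo (x : ℝ) : Finset ℕ := {n ∈ Finset.Icc 1 ⌊x⌋₊ | n ∈ sumTwoSq}

/-- Membership in `S(x)` is membership in `S` together with `1 ≤ n ≤ x`. -/
theorem mem_sumTwoSqUpTo (x : ℝ) (n : ℕ) :
    n ∈ sumTwoSqUpTo x ↔ n ∈ sumTwoSq ∧ 1 ≤ n ∧ (n : ℝ) ≤ x := by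
  simp only [sumTwoSqUpTo, Finset.mem_filter, Finset.mem_Icc]
  constructor
  · rintro ⟨⟨h1, h2⟩, h3⟩
    exact ⟨h3, h1, (Nat.le_floor_iff' (by omega)).1 h2⟩
  · rintro ⟨h3, h1, h2⟩
    exact ⟨⟨h1, Nat.le_floor h2⟩, h3⟩

/-- `ω₁(n)`: the number of distinct primes `p ≡ 1 (mod 4)` dividing `n` (used for `n ≥ 1`). -/
def omegaOne (n : ℕ) : ℕ := {p ∈ n.primeFactors | p ≡ 1 [MOD 4]}.card

namespace TwoSquares

open ArithmeticFunction

/-! ### The arithmetic functions -/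

/-! Write `S(x)` also for the counting function of `S`. Since multiplying by a prime `p ≡ 1 mod 4`
does not affect membership in `S`, exactly `S(x/p)` elements of `S(x)` are divisible by `p`, and
`S(x/pq)` by two such primes. Both moments therefore follow from `S(x/w) ≈ S(x)/w`, together with
Mertens' theorem for the primes `1 mod 4`. Only primes up to `x^(1/4)` need be counted, because an
integer up to `x` has at most four larger ones.

The required approximation, `exists_abs_partialSum_indS_div_sub_le`, has relative error `O((1 + log
w)/log x)`. Summed over `p` against `1/p` this is `O(1)`, as `∑ log p / p = O(log x)`. The errors
obtained are thus `O(1)` and `O(log log x)`, sharper than the stated ones.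

No contour integration or asymptotic formula for `S(x)` is used. The source of everything is `indS *
indOne = rep`, where `rep` has mean value `A > 0` with a power saving by Dirichlet's hyperbola
method, while `indS = indRest * indOne` with `indRest` supported on squares and their doubles.
Roughly, `indS` is a convolution square root of `rep`. Multiplication by `log` is a derivation of
Dirichlet convolution; applied to these identities it yields: (1) `∑ Λ₁(d)/d = (log x)/2 + O(1)`,
where `Λ₁` is `mangoldtOne`; (2) `S(x) ≍ x/√(log x)`, from `∑_{n ≤ x} indS n / n ≍ √(log x)`; (3)
with `μ₁` for `moebiusOne`, `2 S(x) log x = A x ρ(x) + O(x/√(log x))`, where `ρ(x) = ∑ μ₁(d)/d ·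
log(x/d)`. Since `ρ(x) - ρ(y)` is the integral over `[y, x]` of `∑_{d ≤ t} μ₁(d)/d = O(1/√(log t))`
against `dt/t`, it is small, and the slow variation of `S(x)/x` follows. -/

theorem mem_sumTwoSq_iff (n : ℕ) :
    n ∈ sumTwoSq ↔ ∀ q, q % 4 = 3 → Even (n.factorization q) := by
  have h1 : n ∈ sumTwoSq ↔ ∃ x y : ℕ, n = x ^ 2 + y ^ 2 := by
    constructor
    · rintro ⟨a, b, h⟩
      refine ⟨a.natAbs, b.natAbs, ?_⟩
      zify
      simpa using h
    · rintro ⟨a, b, h⟩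
      exact ⟨a, b, by exact_mod_cast h⟩
  rw [h1, Nat.eq_sq_add_sq_iff]
  constructor
  · intro h q hq
    by_cases hqn : q ∈ n.primeFactors
    · have := h q hqn hq
      rwa [Nat.factorization_def _ (Nat.prime_of_mem_primeFactors hqn)]
    · rw [← Nat.support_factorization, Finsupp.notMem_support_iff] at hqn
      simp [hqn]
  · intro h q hqn hq
    rw [← Nat.factorization_def _ (Nat.prime_of_mem_primeFactors hqn)]
    exact h q hq

open Classical in
/-- The indicator function of the positive sums of two squares. -/
noncomputable def indS : ArithmeticFunction ℝ :=
  ⟨fun n => if n ≠ 0 ∧ n ∈ sumTwoSq then 1 else 0, by simp⟩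

open Classical in
/-- The indicator function of the positive integers all of whose prime factors are `1 mod 4`. -/
noncomputable def indOne : ArithmeticFunction ℝ :=
  ⟨fun n => if n ≠ 0 ∧ ∀ p ∈ n.primeFactors, p % 4 = 1 then 1 else 0, by simp⟩

open Classical in
/-- The indicator function of the positive sums of two squares without prime factor `1 mod 4`. -/
noncomputable def indRest : ArithmeticFunction ℝ :=
  ⟨fun n => if n ≠ 0 ∧ n ∈ sumTwoSq ∧ ∀ p ∈ n.primeFactors, p % 4 ≠ 1 then 1 else 0, by simp⟩

/-- The nontrivial character modulo `4`, with real values. -/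
noncomputable def chi : ArithmeticFunction ℝ :=
  ⟨fun n => ((ZMod.χ₄ (n : ZMod 4) : ℤ) : ℝ), by simp⟩

/-- `∑_{d ∣ n} χ₄(d)`, a quarter of the number of representations of `n` as a sum of two squares. -/
noncomputable def rep : ArithmeticFunction ℝ := chi * (zeta : ArithmeticFunction ℝ)

/-- The von Mangoldt function restricted to powers of primes `1 mod 4`. -/
noncomputable def mangoldtOne : ArithmeticFunction ℝ := indOne.pmul vonMangoldt

/-- The Möbius function restricted to products of primes `1 mod 4`. -/
noncomputable def moebiusOne : ArithmeticFunction ℝ :=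
  indOne.pmul ((moebius : ArithmeticFunction ℤ) : ArithmeticFunction ℝ)

/-- Pointwise multiplication by the logarithm. -/
noncomputable def mulLog (a : ArithmeticFunction ℝ) : ArithmeticFunction ℝ := a.pmul log

theorem mulLog_apply (a : ArithmeticFunction ℝ) (n : ℕ) : mulLog a n = a n * Real.log n := rfl

open Classical in
theorem indS_apply (n : ℕ) : indS n = if n ≠ 0 ∧ n ∈ sumTwoSq then 1 else 0 := rfl

open Classical in
theorem indOne_apply (n : ℕ) :
    indOne n = if n ≠ 0 ∧ ∀ p ∈ n.primeFactors, p % 4 = 1 then 1 else 0 := rfl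

open Classical in
theorem indRest_apply (n : ℕ) : indRest n =
    if n ≠ 0 ∧ n ∈ sumTwoSq ∧ ∀ p ∈ n.primeFactors, p % 4 ≠ 1 then 1 else 0 := rfl

theorem chi_apply (n : ℕ) : chi n = ((ZMod.χ₄ (n : ZMod 4) : ℤ) : ℝ) := rfl

theorem chi_mul (m n : ℕ) : chi (m * n) = chi m * chi n := by
  rw [chi_apply, Nat.cast_mul, map_mul, Int.cast_mul, chi_apply, chi_apply]

theorem indS_nonneg (n : ℕ) : 0 ≤ indS n := by
  rw [indS_apply]; split_ifs <;> norm_num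

theorem indS_le_one (n : ℕ) : indS n ≤ 1 := by
  rw [indS_apply]; split_ifs <;> norm_num

theorem indOne_nonneg (n : ℕ) : 0 ≤ indOne n := by
  rw [indOne_apply]; split_ifs <;> norm_num

theorem indOne_le_one (n : ℕ) : indOne n ≤ 1 := by
  rw [indOne_apply]; split_ifs <;> norm_num

theorem indRest_nonneg (n : ℕ) : 0 ≤ indRest n := by
  rw [indRest_apply]; split_ifs <;> norm_num

theorem indRest_le_indS (n : ℕ) : indRest n ≤ indS n := by
  rw [indRest_apply, indS_apply]; split_ifs <;> first | (exfalso; tauto) | norm_num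

theorem indOne_le_indS (n : ℕ) : indOne n ≤ indS n := by
  rw [indOne_apply, indS_apply]
  split_ifs with h1 h2
  · rfl
  · refine absurd ⟨h1.1, (mem_sumTwoSq_iff n).2 fun q hq => ?_⟩ h2
    have : q ∉ n.primeFactors := fun hqn => by have := h1.2 q hqn; omega
    rw [← Nat.support_factorization, Finsupp.notMem_support_iff] at this
    simp [this]
  · norm_num
  · rfl

theorem indOne_mul (m n : ℕ) : indOne (m * n) = indOne m * indOne n := by
  by_cases hm : m = 0
  · simp [hm]
  by_cases hn : n = 0
  · simp [hn]
  simp only [indOne_apply, Nat.primeFactors_mul hm hn, Finset.mem_union, or_imp, forall_and,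
    ne_eq, mul_eq_zero, hm, hn, or_self, not_false_eq_true, true_and]
  split_ifs <;> first | (exfalso; tauto) | norm_num

theorem indOne_one : indOne 1 = 1 := by simp [indOne_apply]

theorem isMultiplicative_indOne : indOne.IsMultiplicative :=
  ⟨indOne_one, fun _ => indOne_mul _ _⟩

theorem mem_sumTwoSq_mul {m n : ℕ} (hm : m ≠ 0) (hn : n ≠ 0) (h : m.Coprime n) :
    m * n ∈ sumTwoSq ↔ m ∈ sumTwoSq ∧ n ∈ sumTwoSq := by
  rw [mem_sumTwoSq_iff m, mem_sumTwoSq_iff n, mem_sumTwoSq_iff (m * n), ← forall_and]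
  refine forall_congr' fun q => ?_
  rw [← imp_and, Nat.factorization_mul hm hn, Finsupp.add_apply]
  refine imp_congr_right fun _ => ?_
  have hd := Nat.Coprime.disjoint_primeFactors h
  by_cases hqm : q ∈ m.primeFactors
  · have : q ∉ n.primeFactors := Finset.disjoint_left.1 hd hqm
    rw [← Nat.support_factorization, Finsupp.notMem_support_iff] at this
    simp [this]
  · rw [← Nat.support_factorization, Finsupp.notMem_support_iff] at hqm
    simp [hqm]

theorem one_mem_sumTwoSq : 1 ∈ sumTwoSq := ⟨1, 0, by norm_num⟩

theorem isMultiplicative_indS : indS.IsMultiplicative := by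
  rw [IsMultiplicative.iff_ne_zero]
  refine ⟨by simp [indS_apply, one_mem_sumTwoSq], fun {m n} hm hn h => ?_⟩
  have h1 := mem_sumTwoSq_mul hm hn h
  have h2 := mul_ne_zero hm hn
  rw [indS_apply, indS_apply, indS_apply]
  split_ifs <;> first | (exfalso; tauto) | norm_num

theorem isMultiplicative_indRest : indRest.IsMultiplicative := by
  rw [IsMultiplicative.iff_ne_zero]
  refine ⟨by simp [indRest_apply, one_mem_sumTwoSq], fun {m n} hm hn h => ?_⟩
  have h1 := mem_sumTwoSq_mul hm hn h
  have h2 := mul_ne_zero hm hn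
  have h3 : (∀ p ∈ (m * n).primeFactors, p % 4 ≠ 1) ↔
      (∀ p ∈ m.primeFactors, p % 4 ≠ 1) ∧ ∀ p ∈ n.primeFactors, p % 4 ≠ 1 := by
    simp only [Nat.primeFactors_mul hm hn, Finset.mem_union, or_imp, forall_and]
  have h4 : (m * n ≠ 0 ∧ m * n ∈ sumTwoSq ∧ ∀ p ∈ (m * n).primeFactors, p % 4 ≠ 1) ↔
      (m ≠ 0 ∧ m ∈ sumTwoSq ∧ ∀ p ∈ m.primeFactors, p % 4 ≠ 1) ∧
      (n ≠ 0 ∧ n ∈ sumTwoSq ∧ ∀ p ∈ n.primeFactors, p % 4 ≠ 1) := by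
    rw [h1, h3]
    exact ⟨fun h => ⟨⟨hm, h.2.1.1, h.2.2.1⟩, hn, h.2.1.2, h.2.2.2⟩,
      fun h => ⟨h2, ⟨h.1.2.1, h.2.2.1⟩, h.1.2.2, h.2.2.2⟩⟩
  rw [indRest_apply, indRest_apply, indRest_apply]
  split_ifs with a b c c b c c
  · norm_num
  · exact absurd (h4.1 a).2 c
  · exact absurd (h4.1 a).1 b
  · exact absurd (h4.1 a).1 b
  · exact absurd (h4.2 ⟨b, c⟩) a
  all_goals norm_num

theorem isMultiplicative_chi : chi.IsMultiplicative :=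
  ⟨by rw [chi_apply, Nat.cast_one, map_one, Int.cast_one], fun _ => chi_mul _ _⟩

theorem isMultiplicative_rep : rep.IsMultiplicative :=
  isMultiplicative_chi.mul isMultiplicative_zeta.natCast

/-! ### Values at prime powers -/

theorem indOne_prime_pow {p : ℕ} (hp : p.Prime) (k : ℕ) :
    indOne (p ^ k) = if k = 0 ∨ p % 4 = 1 then 1 else 0 := by
  rcases eq_or_ne k 0 with rfl | hk
  · simp [indOne_one]
  · simp [indOne_apply, Nat.primeFactors_prime_pow hk hp, hp.ne_zero, hk]

theorem indS_prime_pow {p : ℕ} (hp : p.Prime) (k : ℕ) :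
    indS (p ^ k) = if p % 4 = 3 → Even k then 1 else 0 := by
  have h0 : p ^ k ≠ 0 := pow_ne_zero _ hp.ne_zero
  have : (∀ q, q % 4 = 3 → Even ((p ^ k).factorization q)) ↔ (p % 4 = 3 → Even k) := by
    rw [hp.factorization_pow]
    constructor
    · intro h h3
      simpa using h p h3
    · intro h q hq
      by_cases hqp : p = q
      · subst hqp; simpa using h hq
      · simp [hqp]
  simp only [indS_apply, mem_sumTwoSq_iff (p ^ k), this, h0, ne_eq, not_false_eq_true, true_and]

theorem indRest_prime_pow {p : ℕ} (hp : p.Prime) (k : ℕ) :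
    indRest (p ^ k) = if (p % 4 = 3 → Even k) ∧ (p % 4 = 1 → k = 0) then 1 else 0 := by
  have h1 := indS_prime_pow hp k
  have h0 : p ^ k ≠ 0 := pow_ne_zero _ hp.ne_zero
  rcases eq_or_ne k 0 with rfl | hk
  · simp [isMultiplicative_indRest.map_one]
  · have h2 : indRest (p ^ k) = if p % 4 = 1 then 0 else indS (p ^ k) := by
      have h3 : (∀ q ∈ (p ^ k).primeFactors, q % 4 ≠ 1) ↔ p % 4 ≠ 1 := by
        simp [Nat.primeFactors_prime_pow hk hp]
      rw [indRest_apply, indS_apply]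
      split_ifs <;> first | (exfalso; tauto) | rfl
    rw [h2, h1]
    split_ifs <;> first | (exfalso; tauto) | rfl

theorem rep_prime_pow {p : ℕ} (hp : p.Prime) (k : ℕ) :
    rep (p ^ k) = if p % 4 = 1 then (k : ℝ) + 1 else if p % 4 = 3 → Even k then 1 else 0 := by
  have h : rep (p ^ k) = ∑ i ∈ Finset.range (k + 1), chi p ^ i := by
    rw [rep, coe_mul_zeta_apply, Nat.sum_divisors_prime_pow hp]
    refine Finset.sum_congr rfl fun i _ => ?_
    rw [chi_apply, chi_apply, Nat.cast_pow, map_pow, Int.cast_pow]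
  rw [h]
  have hc : chi p = if p % 2 = 0 then 0 else if p % 4 = 1 then 1 else -1 := by
    rw [chi_apply, ZMod.χ₄_nat_eq_if_mod_four]
    split_ifs <;> simp
  by_cases h1 : p % 4 = 1
  · rw [hc, if_neg (by omega), if_pos h1, if_pos h1]; simp
  · rw [if_neg h1]
    by_cases h3 : p % 4 = 3
    · rw [hc, if_neg (by omega), if_neg h1]
      simp only [h3, forall_const]
      rw [neg_one_geom_sum]
      simp only [Nat.even_add_one]
      split_ifs <;> tauto
    · rw [if_pos (fun h => absurd h h3), hc, if_pos (by omega)]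
      rw [Finset.sum_range_succ']
      simp

/-! ### Convolution identities -/

theorem mul_prime_pow_apply (a b : ArithmeticFunction ℝ) {p : ℕ} (hp : p.Prime) (k : ℕ) :
    (a * b) (p ^ k) = ∑ i ∈ Finset.range (k + 1), a (p ^ i) * b (p ^ (k - i)) := by
  rw [mul_apply, Nat.sum_divisorsAntidiagonal (fun x y => a x * b y), Nat.sum_divisors_prime_pow hp]
  refine Finset.sum_congr rfl fun i hi => ?_
  rw [Nat.pow_div (by simpa [Nat.lt_succ_iff] using hi) hp.pos]

theorem indRest_mul_indOne : indRest * indOne = indS := by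
  refine (IsMultiplicative.eq_iff_eq_on_prime_powers _
    (isMultiplicative_indRest.mul isMultiplicative_indOne) _ isMultiplicative_indS).2 fun p k hp => ?_
  rw [mul_prime_pow_apply _ _ hp]
  by_cases h1 : p % 4 = 1
  · rw [Finset.sum_eq_single_of_mem 0 (by simp)]
    · simp [isMultiplicative_indRest.map_one, indOne_prime_pow hp, indS_prime_pow hp, h1]
    · intro i _ hi
      simp [indRest_prime_pow hp, h1, hi]
  · rw [Finset.sum_eq_single_of_mem k (by simp)]
    · simp [indRest_prime_pow hp, indOne_one, indS_prime_pow hp, h1]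
    · intro i hi hik
      have : k - i ≠ 0 := by simp at hi; omega
      simp [indOne_prime_pow hp, h1, this]

/-- At `p ^ k` with `p ≡ 1 mod 4` all `k + 1` terms of the convolution equal `1`; at other primes
only the term with `indOne 1` survives. This makes `indS` accessible from a function whose average
order is elementary. -/
theorem indS_mul_indOne : indS * indOne = rep := by
  refine (IsMultiplicative.eq_iff_eq_on_prime_powers _
    (isMultiplicative_indS.mul isMultiplicative_indOne) _ isMultiplicative_rep).2 fun p k hp => ?_
  rw [mul_prime_pow_apply _ _ hp, rep_prime_pow hp]
  by_cases h1 : p % 4 = 1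
  · rw [if_pos h1]
    simp [indS_prime_pow hp, indOne_prime_pow hp, h1]
  · rw [if_neg h1, Finset.sum_eq_single_of_mem k (by simp)]
    · simp [indOne_one, indS_prime_pow hp]
    · intro i hi hik
      have : k - i ≠ 0 := by simp at hi; omega
      simp [indOne_prime_pow hp, h1, this]

/-- Complete multiplicativity of `indOne` makes the twist a ring homomorphism for convolution, so `ζ
* Λ = log` and `ζ * μ = 1` pass to the primes `1 mod 4`. -/
theorem indOne_pmul_mul (a b : ArithmeticFunction ℝ) :
    indOne.pmul (a * b) = indOne.pmul a * indOne.pmul b := by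
  ext n
  simp only [pmul_apply, mul_apply, Finset.mul_sum]
  refine Finset.sum_congr rfl fun d hd => ?_
  rw [← (Nat.mem_divisorsAntidiagonal.1 hd).1, indOne_mul]
  ring

theorem mulLog_mul (a b : ArithmeticFunction ℝ) :
    mulLog (a * b) = mulLog a * b + a * mulLog b := by
  ext n
  simp only [ArithmeticFunction.add_apply, mulLog_apply, mul_apply, Finset.sum_mul, ← Finset.sum_add_distrib]
  refine Finset.sum_congr rfl fun d hd => ?_
  have h := Nat.mem_divisorsAntidiagonal.1 hd
  have h1 : (d.1 : ℝ) ≠ 0 := by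
    intro h0; apply h.2; rw [← h.1]; simp [Nat.cast_eq_zero.1 h0]
  have h2 : (d.2 : ℝ) ≠ 0 := by
    intro h0; apply h.2; rw [← h.1]; simp [Nat.cast_eq_zero.1 h0]
  rw [← h.1, Nat.cast_mul, Real.log_mul h1 h2]
  ring

theorem mulLog_indOne : mulLog indOne = indOne * mangoldtOne := by
  have h := indOne_pmul_mul (zeta : ArithmeticFunction ℝ) vonMangoldt
  rw [zeta_mul_vonMangoldt, pmul_zeta] at h
  exact h

theorem indOne_mul_moebiusOne : indOne * moebiusOne = 1 := by
  have h := indOne_pmul_mul (zeta : ArithmeticFunction ℝ) ((moebius : ArithmeticFunction ℤ) :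
    ArithmeticFunction ℝ)
  rw [coe_zeta_mul_coe_moebius, pmul_zeta] at h
  rw [moebiusOne, ← h]
  ext n
  by_cases hn : n = 1
  · simp [hn, indOne_one]
  · simp [hn]

theorem indS_eq_moebiusOne_mul_rep : indS = moebiusOne * rep := by
  rw [← indS_mul_indOne, mul_comm, mul_assoc, indOne_mul_moebiusOne, mul_one]

/-- Leibniz rule for `indRest * indOne`. The derivative of `indRest` is left as it is: being sparse,
it only ever contributes to error terms. -/
theorem mulLog_indS : mulLog indS = indS * mangoldtOne + mulLog indRest * indOne := by
  nth_rewrite 1 [← indRest_mul_indOne]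
  rw [mulLog_mul, mulLog_indOne, ← mul_assoc, indRest_mul_indOne, add_comm]

theorem mulLog_rep :
    mulLog rep = 2 * (rep * mangoldtOne) + mulLog indRest * (indOne * indOne) := by
  rw [← indS_mul_indOne, mulLog_mul, mulLog_indS, mulLog_indOne]
  ring

/-- Convolving `mulLog_rep` with `moebiusOne` gives `2 (indS * mangoldtOne) + mulLog indRest *
indOne`. The gain is that no sum over primes remains: `mulLog rep` has a smooth mean value. -/
theorem two_mul_mulLog_indS :
    2 * mulLog indS = moebiusOne * mulLog rep + mulLog indRest * indOne := by
  rw [mulLog_rep, mulLog_indS, ← indS_mul_indOne]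
  linear_combination (-2 * indS * mangoldtOne - mulLog indRest * indOne) * indOne_mul_moebiusOne

/-! ### Summatory functions -/

/-- The summatory function `∑_{1 ≤ n ≤ x} c n`. -/
noncomputable def partialSum (c : ℕ → ℝ) (x : ℝ) : ℝ := ∑ n ∈ Finset.Ioc 0 ⌊x⌋₊, c n

theorem mem_Ioc_floor {x : ℝ} {n : ℕ} (h : n ∈ Finset.Ioc 0 ⌊x⌋₊) : 1 ≤ (n : ℝ) ∧ (n : ℝ) ≤ x := by
  rw [Finset.mem_Ioc] at h
  exact ⟨by exact_mod_cast h.1, (Nat.le_floor_iff' (by omega)).1 h.2⟩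

theorem partialSum_mul (a b : ArithmeticFunction ℝ) (x : ℝ) :
    partialSum ⇑(a * b) x = ∑ d ∈ Finset.Ioc 0 ⌊x⌋₊, a d * partialSum b (x / d) := by
  rw [partialSum, sum_Ioc_mul_eq_sum_sum]
  refine Finset.sum_congr rfl fun d _ => ?_
  rw [partialSum, Nat.floor_div_natCast]

theorem partialSum_nonneg {c : ℕ → ℝ} (hc : ∀ n, 0 ≤ c n) (x : ℝ) : 0 ≤ partialSum c x :=
  Finset.sum_nonneg fun n _ => hc n

theorem partialSum_mono {c : ℕ → ℝ} (hc : ∀ n, 0 ≤ c n) {x y : ℝ} (h : x ≤ y) :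
    partialSum c x ≤ partialSum c y :=
  Finset.sum_le_sum_of_subset_of_nonneg
    (Finset.Ioc_subset_Ioc_right (Nat.floor_mono h)) fun n _ _ => hc n

theorem partialSum_le_self {c : ℕ → ℝ} (hc : ∀ n, c n ≤ 1) {x : ℝ} (hx : 0 ≤ x) :
    partialSum c x ≤ x := by
  refine (Finset.sum_le_sum fun n _ => hc n).trans ?_
  simpa using Nat.floor_le hx

theorem sum_Icc_zero_eq {c : ℕ → ℝ} (hc : c 0 = 0) (N : ℕ) :
    ∑ n ∈ Finset.Icc 0 N, c n = ∑ n ∈ Finset.Ioc 0 N, c n := by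
  rw [Finset.Icc_eq_cons_Ioc (Nat.zero_le _), Finset.sum_cons, hc, zero_add]

theorem intervalIntegrable_partialSum_div (c : ℕ → ℝ) {x y : ℝ} (hx : 0 < x) (hxy : x ≤ y) :
    IntervalIntegrable (fun t => partialSum c t / t) MeasureTheory.volume x y := by
  rw [intervalIntegrable_iff_integrableOn_Icc_of_le hxy]
  have hint : MeasureTheory.IntegrableOn (fun t : ℝ => t⁻¹) (Set.Icc x y) :=
    (continuousOn_inv₀.mono fun t ht => (hx.trans_le ht.1).ne').integrableOn_Icc
  have h := integrableOn_mul_sum_Icc (m := 1) c hx.le hint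
  refine h.congr_fun (fun t _ => ?_) measurableSet_Icc
  rw [partialSum, div_eq_inv_mul]
  rfl

/-- Abel summation with the weight `log x - log t`, which vanishes at `t = x`, so there is no
boundary term. -/
theorem sum_mul_log_div {c : ℕ → ℝ} (hc : c 0 = 0) {x : ℝ} (hx : 1 ≤ x) :
    ∑ n ∈ Finset.Ioc 0 ⌊x⌋₊, c n * Real.log (x / n) = ∫ t in (1 : ℝ)..x, partialSum c t / t := by
  have hx0 : 0 < x := one_pos.trans_le hx
  have hd : ∀ t ∈ Set.Icc 1 x, HasDerivAt (fun t => Real.log x - Real.log t) (-t⁻¹) t := by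
    intro t ht
    exact (Real.hasDerivAt_log (one_pos.trans_le ht.1).ne').const_sub _
  have hderiv : Set.EqOn (deriv fun t => Real.log x - Real.log t) (fun t => -t⁻¹) (Set.Icc 1 x) :=
    fun t ht => (hd t ht).deriv
  have hint : MeasureTheory.IntegrableOn (fun t : ℝ => -t⁻¹) (Set.Icc 1 x) :=
    (continuousOn_inv₀.neg.mono fun t ht => (one_pos.trans_le ht.1).ne').integrableOn_Icc
  have h := sum_mul_eq_sub_integral_mul₀ c hc x (fun t ht => (hd t ht).differentiableAt)
    (hint.congr_fun hderiv.symm measurableSet_Icc)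
  rw [sub_self, zero_mul, zero_sub, ← MeasureTheory.integral_neg,
    sum_Icc_zero_eq (by simp [hc])] at h
  rw [intervalIntegral.integral_of_le hx]
  calc ∑ n ∈ Finset.Ioc 0 ⌊x⌋₊, c n * Real.log (x / n)
      = ∑ n ∈ Finset.Ioc 0 ⌊x⌋₊, (Real.log x - Real.log n) * c n := by
        refine Finset.sum_congr rfl fun n hn => ?_
        rw [Real.log_div hx0.ne' (one_pos.trans_le (mem_Ioc_floor hn).1).ne', mul_comm]
    _ = _ := by
        rw [h]
        refine MeasureTheory.setIntegral_congr_fun measurableSet_Ioc fun t ht => ?_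
        rw [hderiv (Set.Ioc_subset_Icc_self ht), sum_Icc_zero_eq hc, partialSum]
        simp only [neg_mul, neg_neg]
        rw [div_eq_inv_mul]

/-- The difference is the integral of `partialSum c t / t` over `[y, x]`; only partial sums in that
range matter. -/
theorem abs_sum_mul_log_div_sub_le {c : ℕ → ℝ} (hc : c 0 = 0) {x y B : ℝ} (hy : 1 ≤ y)
    (hxy : y ≤ x) (hB : ∀ t, y ≤ t → t ≤ x → |partialSum c t| ≤ B) :
    |∑ n ∈ Finset.Ioc 0 ⌊x⌋₊, c n * Real.log (x / n) -
      ∑ n ∈ Finset.Ioc 0 ⌊y⌋₊, c n * Real.log (y / n)| ≤ B * Real.log (x / y) := by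
  have hy0 : 0 < y := one_pos.trans_le hy
  rw [sum_mul_log_div hc hy, sum_mul_log_div hc (hy.trans hxy),
    intervalIntegral.integral_interval_sub_left
      (intervalIntegrable_partialSum_div c one_pos (hy.trans hxy))
      (intervalIntegrable_partialSum_div c one_pos hy)]
  rw [← integral_inv_of_pos hy0 (hy0.trans_le hxy), ← intervalIntegral.integral_const_mul,
    ← Real.norm_eq_abs]
  refine intervalIntegral.norm_integral_le_of_norm_le hxy ?_ ?_
  · refine Filter.Eventually.of_forall fun t ht => ?_
    have ht0 : 0 < t := hy0.trans ht.1
    rw [Real.norm_eq_abs, abs_div, abs_of_pos ht0, div_eq_mul_inv]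
    exact mul_le_mul_of_nonneg_right (hB t ht.1.le ht.2) (inv_nonneg.2 ht0.le)
  · refine ContinuousOn.intervalIntegrable ?_
    rw [Set.uIcc_of_le hxy]
    exact continuousOn_const.mul
      (continuousOn_inv₀.mono fun t ht => (hy0.trans_le ht.1).ne')

/-! ### The average order of `rep` -/

theorem abs_sum_mul_antitone_le {c u : ℕ → ℝ} {B : ℝ} {m : ℕ}
    (hc : ∀ k, |∑ n ∈ Finset.Ioc m k, c n| ≤ B) (hu0 : ∀ n, m < n → 0 ≤ u n)
    (hu : ∀ n, m < n → u (n + 1) ≤ u n) (N : ℕ) :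
    |∑ n ∈ Finset.Ioc m N, c n * u n| ≤ B * u (m + 1) := by
  have hB : 0 ≤ B := (abs_nonneg _).trans (hc m)
  rcases Nat.lt_or_ge m N with h | h
  -- Abel's inequality: removing the boundary term makes the bound telescope, hence suitable for
  -- induction.
  · have key : |∑ n ∈ Finset.Ioc m N, c n * u n - (∑ n ∈ Finset.Ioc m N, c n) * u N| ≤
        B * (u (m + 1) - u N) := by
      induction N, h using Nat.le_induction with
      | base => simp
      | succ N hN ih =>
        rw [← Finset.insert_Ioc_right_eq_Ioc_add_one (by omega), Finset.sum_insert (by simp),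
          Finset.sum_insert (by simp)]
        have h1 : c (N + 1) * u (N + 1) + ∑ n ∈ Finset.Ioc m N, c n * u n -
            (c (N + 1) + ∑ n ∈ Finset.Ioc m N, c n) * u (N + 1) =
            (∑ n ∈ Finset.Ioc m N, c n * u n - (∑ n ∈ Finset.Ioc m N, c n) * u N) +
            (∑ n ∈ Finset.Ioc m N, c n) * (u N - u (N + 1)) := by ring
        have h2 : 0 ≤ u N - u (N + 1) := sub_nonneg.2 (hu N hN)
        rw [h1]
        refine (abs_add_le _ _).trans ?_
        rw [abs_mul, abs_of_nonneg h2]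
        have := mul_le_mul_of_nonneg_right (hc N) h2
        linarith
    have h3 : |(∑ n ∈ Finset.Ioc m N, c n) * u N| ≤ B * u N := by
      rw [abs_mul, abs_of_nonneg (hu0 N h)]
      exact mul_le_mul_of_nonneg_right (hc N) (hu0 N h)
    have h4 := abs_sub_abs_le_abs_sub (∑ n ∈ Finset.Ioc m N, c n * u n)
      ((∑ n ∈ Finset.Ioc m N, c n) * u N)
    linarith
  · rw [Finset.Ioc_eq_empty (by omega)]
    simpa using mul_nonneg hB (hu0 (m + 1) (by omega))

theorem chi_eq (n : ℕ) : chi n = if n % 4 = 1 then 1 else if n % 4 = 3 then -1 else 0 := by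
  rw [chi_apply, ZMod.χ₄_nat_eq_if_mod_four]
  split_ifs <;> first | omega | simp

theorem sum_chi (N : ℕ) :
    ∑ n ∈ Finset.Ioc 0 N, chi n = if N % 4 = 1 ∨ N % 4 = 2 then 1 else 0 := by
  induction N with
  | zero => simp
  | succ N ih =>
    rw [← Finset.insert_Ioc_right_eq_Ioc_add_one (by omega), Finset.sum_insert (by simp), ih, chi_eq]
    split_ifs <;> first | omega | norm_num

theorem abs_sum_chi_le (m k : ℕ) : |∑ n ∈ Finset.Ioc m k, chi n| ≤ 1 := by
  rcases le_or_gt m k with h | h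
  · have := Finset.sum_Ioc_consecutive (fun n => chi n) (Nat.zero_le m) h
    rw [sum_chi, sum_chi] at this
    rw [abs_le]
    split_ifs at this <;> constructor <;> linarith
  · rw [Finset.Ioc_eq_empty (by omega)]
    simp

theorem abs_chi_le (n : ℕ) : |chi n| ≤ 1 := by
  rw [chi_eq]
  split_ifs <;> simp

theorem exists_sum_chi_div :
    ∃ A : ℝ, 0 < A ∧ ∀ m : ℕ, |∑ n ∈ Finset.Ioc 0 m, chi n / n - A| ≤ 1 / ((m : ℝ) + 1) := by
  have tail : ∀ m N : ℕ, m ≤ N →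
      |∑ n ∈ Finset.Ioc 0 N, chi n / n - ∑ n ∈ Finset.Ioc 0 m, chi n / n| ≤ 1 / ((m : ℝ) + 1) := by
    intro m N h
    rw [← Finset.sum_Ioc_consecutive _ (Nat.zero_le m) h, add_sub_cancel_left]
    have := abs_sum_mul_antitone_le (c := chi) (u := fun n => 1 / (n : ℝ)) (abs_sum_chi_le m)
      (fun n _ => by positivity) (fun n hn => by
        have : 0 < (n : ℝ) := by exact_mod_cast (by omega : 0 < n)
        push_cast
        gcongr
        linarith) N
    simpa [div_eq_mul_inv] using this
  have hcau : CauchySeq fun N : ℕ => ∑ n ∈ Finset.Ioc 0 N, chi n / n := by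
    refine cauchySeq_of_le_tendsto_0' (fun m : ℕ => 1 / ((m : ℝ) + 1)) (fun m N h => ?_)
      tendsto_one_div_add_atTop_nhds_zero_nat
    rw [dist_comm, Real.dist_eq]
    exact tail m N h
  obtain ⟨A, hA⟩ := cauchySeq_tendsto_of_complete hcau
  have hbound : ∀ m : ℕ, |∑ n ∈ Finset.Ioc 0 m, chi n / n - A| ≤ 1 / ((m : ℝ) + 1) := by
    intro m
    rw [abs_sub_comm]
    refine le_of_tendsto ((hA.sub_const _).abs) ?_
    filter_upwards [eventually_ge_atTop m] with N hN
    exact tail m N hN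
  refine ⟨A, ?_, hbound⟩
  -- The first partial sum is `1` with error at most `1/2`, so `A ≥ 1/2`.
  have h1 := hbound 1
  rw [abs_le] at h1
  norm_num [chi_eq] at h1
  linarith

/-- Hyperbola method, cut at `√y`. For `a ≤ √y`, dropping the floor in `⌊y/a⌋` costs at most `1` per
term; for larger `a` the floor is antitone and at most `√y`, and character sums are bounded by `1`.
-/
theorem exists_partialSum_rep :
    ∃ A C : ℝ, 0 < A ∧ 0 < C ∧ ∀ y : ℝ, 0 ≤ y → |partialSum rep y - A * y| ≤ C * √y := by
  obtain ⟨A, hA, hm⟩ := exists_sum_chi_div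
  -- Three errors of size `√y`; the summand `A` serves `y < 1`, where the sum is empty and `y ≤ √y`.
  refine ⟨A, 3 + A, hA, by positivity, fun y hy => ?_⟩
  rcases lt_or_ge y 1 with hy1 | hy1
  · have : partialSum rep y = 0 := by
      rw [partialSum, Nat.floor_eq_zero.2 hy1]; simp
    rw [this, zero_sub, abs_neg, abs_of_nonneg (by positivity)]
    have h1 : y ≤ √y := Real.le_sqrt_of_sq_le (by nlinarith)
    have h2 := Real.sqrt_nonneg y
    nlinarith
  set s := ⌊√y⌋₊ with hs
  have hsq1 : 1 ≤ √y := Real.one_le_sqrt.2 hy1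
  have hsqy : √y * √y = y := Real.mul_self_sqrt hy
  have hs1 : (s : ℝ) ≤ √y := Nat.floor_le (Real.sqrt_nonneg y)
  have hs2 : √y < s + 1 := Nat.lt_floor_add_one _
  have hsN : s ≤ ⌊y⌋₊ := Nat.floor_mono (by nlinarith)
  have hdiv : y / (s + 1) ≤ √y := by
    rw [div_le_iff₀ (by positivity)]
    nlinarith
  have hrep : partialSum rep y = ∑ a ∈ Finset.Ioc 0 ⌊y⌋₊, chi a * (⌊y / a⌋₊ : ℝ) := by
    rw [rep, partialSum, sum_Ioc_mul_zeta_eq_sum]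
    refine Finset.sum_congr rfl fun a _ => ?_
    rw [Nat.floor_div_natCast]
  rw [hrep, ← Finset.sum_Ioc_consecutive _ (Nat.zero_le s) hsN]
  have h1 : |∑ a ∈ Finset.Ioc 0 s, (chi a * (⌊y / a⌋₊ : ℝ) - chi a * (y / a))| ≤ √y := by
    refine (Finset.abs_sum_le_sum_abs _ _).trans ?_
    refine le_trans (Finset.sum_le_sum (g := fun _ => (1 : ℝ)) fun a _ => ?_) (by simpa using hs1)
    rw [← mul_sub, abs_mul]
    refine mul_le_one₀ (abs_chi_le a) (abs_nonneg _) ?_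
    have h2 := Nat.floor_le (by positivity : 0 ≤ y / a)
    have h3 := Nat.lt_floor_add_one (y / a)
    rw [abs_le]
    constructor <;> linarith
  have h2 : |∑ a ∈ Finset.Ioc 0 s, chi a * (y / a) - A * y| ≤ √y := by
    have : ∑ a ∈ Finset.Ioc 0 s, chi a * (y / a) - A * y =
        y * (∑ a ∈ Finset.Ioc 0 s, chi a / a - A) := by
      rw [mul_sub, Finset.mul_sum, mul_comm A]
      congr 1
      exact Finset.sum_congr rfl fun a _ => by ring
    rw [this, abs_mul, abs_of_nonneg hy]
    refine (mul_le_mul_of_nonneg_left (hm s) hy).trans ?_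
    rwa [mul_one_div]
  have h3 : |∑ a ∈ Finset.Ioc s ⌊y⌋₊, chi a * (⌊y / a⌋₊ : ℝ)| ≤ √y := by
    have := abs_sum_mul_antitone_le (c := chi) (u := fun a => (⌊y / a⌋₊ : ℝ)) (abs_sum_chi_le s)
      (fun n _ => by positivity) (fun n hn => by
        have : 0 < (n : ℝ) := by exact_mod_cast (by omega : 0 < n)
        have h : y / ((n + 1 : ℕ) : ℝ) ≤ y / n := by
          push_cast
          gcongr
          linarith
        exact_mod_cast Nat.floor_mono h) ⌊y⌋₊
    refine this.trans ?_
    rw [one_mul]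
    refine (Nat.floor_le (by positivity)).trans ?_
    push_cast
    exact hdiv
  have h4 : ∑ a ∈ Finset.Ioc 0 s, chi a * (⌊y / a⌋₊ : ℝ) +
      ∑ a ∈ Finset.Ioc s ⌊y⌋₊, chi a * (⌊y / a⌋₊ : ℝ) - A * y =
      ∑ a ∈ Finset.Ioc 0 s, (chi a * (⌊y / a⌋₊ : ℝ) - chi a * (y / a)) +
      (∑ a ∈ Finset.Ioc 0 s, chi a * (y / a) - A * y) +
      ∑ a ∈ Finset.Ioc s ⌊y⌋₊, chi a * (⌊y / a⌋₊ : ℝ) := by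
    rw [Finset.sum_sub_distrib]; ring
  rw [h4]
  have h5 := abs_add_three (∑ a ∈ Finset.Ioc 0 s, (chi a * (⌊y / a⌋₊ : ℝ) - chi a * (y / a)))
    (∑ a ∈ Finset.Ioc 0 s, chi a * (y / a) - A * y)
    (∑ a ∈ Finset.Ioc s ⌊y⌋₊, chi a * (⌊y / a⌋₊ : ℝ))
  have h6 : 0 ≤ A * √y := by positivity
  linarith

/-- The mean value of `rep`. -/
noncomputable def repMean : ℝ := exists_partialSum_rep.choose

theorem repMean_pos : 0 < repMean := exists_partialSum_rep.choose_spec.choose_spec.1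

theorem exists_abs_partialSum_rep_sub_le :
    ∃ C : ℝ, 0 < C ∧ ∀ y : ℝ, 0 ≤ y → |partialSum rep y - repMean * y| ≤ C * √y :=
  ⟨_, exists_partialSum_rep.choose_spec.choose_spec.2⟩

theorem sqrt_le_rpow {y : ℝ} (hy : 1 ≤ y) : √y ≤ y ^ (3 / 4 : ℝ) := by
  rw [Real.sqrt_eq_rpow]
  exact Real.rpow_le_rpow_of_exponent_le hy (by norm_num)

theorem exists_abs_partialSum_rep_sub_le_rpow :
    ∃ C : ℝ, 0 < C ∧ ∀ y : ℝ, 1 ≤ y →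
      |partialSum rep y - repMean * y| ≤ C * y ^ (3 / 4 : ℝ) := by
  obtain ⟨C, hC, h⟩ := exists_abs_partialSum_rep_sub_le
  exact ⟨C, hC, fun y hy => (h y (by linarith)).trans
    (mul_le_mul_of_nonneg_left (sqrt_le_rpow hy) hC.le)⟩

theorem rep_nonneg (n : ℕ) : 0 ≤ rep n := by
  rw [← indS_mul_indOne, mul_apply]
  exact Finset.sum_nonneg fun d _ => mul_nonneg (indS_nonneg _) (indOne_nonneg _)

theorem exists_partialSum_rep_le : ∃ C : ℝ, 0 < C ∧ ∀ y : ℝ, 1 ≤ y → partialSum rep y ≤ C * y := by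
  obtain ⟨C, hC, h⟩ := exists_abs_partialSum_rep_sub_le
  refine ⟨repMean + C, by linarith [repMean_pos], fun y hy => ?_⟩
  have h1 := (abs_le.1 (h y (by linarith))).2
  have h2 : √y ≤ y := (Real.sqrt_le_left (by linarith)).2 (by nlinarith)
  nlinarith

theorem exists_abs_partialSum_mulLog_rep_sub_le :
    ∃ C : ℝ, 0 < C ∧ ∀ y : ℝ, 1 ≤ y →
      |partialSum (mulLog rep) y - (repMean * y * Real.log y - repMean * y)| ≤
        C * y ^ (3 / 4 : ℝ) := by
  obtain ⟨C, hC, h⟩ := exists_abs_partialSum_rep_sub_le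
  -- `4 C` from `log y · √y ≤ 4 y^(3/4)`, `2 C` from the integrated error, and `repMean` from the
  -- lower limit `1` of the main integral.
  refine ⟨6 * C + repMean, by linarith [repMean_pos], fun y hy => ?_⟩
  have hy0 : 0 < y := by linarith
  have hlog : 0 ≤ Real.log y := Real.log_nonneg hy
  have hsplit : partialSum (mulLog rep) y =
      Real.log y * partialSum rep y - ∑ n ∈ Finset.Ioc 0 ⌊y⌋₊, rep n * Real.log (y / n) := by
    rw [partialSum, partialSum, Finset.mul_sum, ← Finset.sum_sub_distrib]
    refine Finset.sum_congr rfl fun n hn => ?_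
    rw [mulLog_apply, Real.log_div hy0.ne' (one_pos.trans_le (mem_Ioc_floor hn).1).ne']
    ring
  have hint : |∑ n ∈ Finset.Ioc 0 ⌊y⌋₊, rep n * Real.log (y / n) - repMean * (y - 1)| ≤
      C * (2 * √y) := by
    have h1 : repMean * (y - 1) = ∫ _ in (1 : ℝ)..y, repMean := by simp [mul_comm]
    rw [sum_mul_log_div (by simp) hy, h1, ← intervalIntegral.integral_sub
      (intervalIntegrable_partialSum_div _ one_pos hy) intervalIntegrable_const,
      ← Real.norm_eq_abs]
    have h2 : (∫ t in (1 : ℝ)..y, C * t ^ (-(1 / 2) : ℝ)) = C * ((y ^ (1 / 2 : ℝ) - 1) / (1 / 2)) := by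
      rw [intervalIntegral.integral_const_mul, integral_rpow (Or.inl (by norm_num))]
      norm_num
    have h3 : C * ((y ^ (1 / 2 : ℝ) - 1) / (1 / 2)) ≤ C * (2 * √y) := by
      rw [Real.sqrt_eq_rpow]
      refine mul_le_mul_of_nonneg_left ?_ hC.le
      linarith
    refine le_trans ?_ (h2.trans_le h3)
    refine intervalIntegral.norm_integral_le_of_norm_le hy ?_ ?_
    · refine Filter.Eventually.of_forall fun t ht => ?_
      have ht0 : 0 < t := one_pos.trans ht.1
      have h4 : partialSum rep t / t - repMean = (partialSum rep t - repMean * t) / t := by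
        field_simp
      rw [h4, Real.norm_eq_abs, abs_div, abs_of_pos ht0, div_le_iff₀ ht0]
      refine (h t ht0.le).trans_eq ?_
      rw [mul_assoc, ← Real.rpow_add_one ht0.ne', Real.sqrt_eq_rpow]
      norm_num
    · exact (intervalIntegral.intervalIntegrable_rpow' (by norm_num)).const_mul _
  have hl : Real.log y * √y ≤ 4 * y ^ (3 / 4 : ℝ) := by
    have h1 := Real.log_le_rpow_div hy0.le (by norm_num : (0 : ℝ) < 1 / 4)
    have h2 : y ^ (3 / 4 : ℝ) = y ^ (1 / 4 : ℝ) * √y := by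
      rw [Real.sqrt_eq_rpow, ← Real.rpow_add hy0]; norm_num
    rw [h2]
    have := mul_le_mul_of_nonneg_right h1 (Real.sqrt_nonneg y)
    linarith
  have h1 := h y hy0.le
  have h2 : |Real.log y * (partialSum rep y - repMean * y)| ≤ C * (Real.log y * √y) := by
    rw [abs_mul, abs_of_nonneg hlog]
    nlinarith
  have hs := sqrt_le_rpow hy
  have h3 : 1 ≤ y ^ (3 / 4 : ℝ) := Real.one_le_rpow hy (by norm_num)
  have hA := repMean_pos
  have h4 : C * (Real.log y * √y) ≤ C * (4 * y ^ (3 / 4 : ℝ)) := mul_le_mul_of_nonneg_left hl hC.le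
  have h5 : C * (2 * √y) ≤ C * (2 * y ^ (3 / 4 : ℝ)) := mul_le_mul_of_nonneg_left (by linarith) hC.le
  have h6 : repMean * 1 ≤ repMean * y ^ (3 / 4 : ℝ) := mul_le_mul_of_nonneg_left h3 hA.le
  rw [hsplit]
  rw [abs_le] at hint h2 ⊢
  constructor <;> linarith [hint.1, hint.2, h2.1, h2.2]

/-! ### Sums over numbers without prime factor `1 mod 4` -/

/-- Primes `3 mod 4` occur to even powers and primes `1 mod 4` not at all, so the squarefree part is
`1` or `2`. -/
theorem exists_sq_of_indRest_ne_zero {n : ℕ} (h : indRest n ≠ 0) :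
    ∃ c : ℕ, n = c ^ 2 ∨ n = 2 * c ^ 2 := by
  obtain ⟨hn, hS, h1⟩ : n ≠ 0 ∧ n ∈ sumTwoSq ∧ ∀ p ∈ n.primeFactors, p % 4 ≠ 1 := by
    by_contra h0
    exact h (by rw [indRest_apply, if_neg h0])
  rw [mem_sumTwoSq_iff n] at hS
  obtain ⟨a, b, hab, ha⟩ := Nat.sq_mul_squarefree n
  have hb0 : b ≠ 0 := by rintro rfl; simp at hab; omega
  have ha0 : a ≠ 0 := ha.ne_zero
  have hp2 : ∀ p ∈ a.primeFactors, p = 2 := by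
    intro p hp
    have hpp := Nat.prime_of_mem_primeFactors hp
    have hpa := Nat.dvd_of_mem_primeFactors hp
    have hfac : n.factorization p = 2 * b.factorization p + 1 := by
      have h3 : a.factorization p = 1 := by
        have h4 := (Nat.squarefree_iff_factorization_le_one ha0).1 ha p
        have h5 := hpp.factorization_pos_of_dvd ha0 hpa
        omega
      rw [← hab, Nat.factorization_mul (pow_ne_zero 2 hb0) ha0, Nat.factorization_pow,
        Finsupp.add_apply, Finsupp.smul_apply, h3, smul_eq_mul]
    have h3 : p % 4 ≠ 3 := by
      intro h3
      have := hS p h3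
      rw [hfac] at this
      exact (Nat.not_even_iff_odd.2 ⟨_, rfl⟩) this
    have h4 : p % 4 ≠ 1 := h1 p (Nat.mem_primeFactors.2
      ⟨hpp, hab ▸ hpa.mul_left _, hn⟩)
    rcases hpp.eq_two_or_odd with h5 | h5
    · exact h5
    · omega
  have hsub : a.primeFactors ⊆ {2} := fun p hp => by simpa using hp2 p hp
  have hprod := Nat.prod_primeFactors_of_squarefree ha
  rcases Finset.subset_singleton_iff.1 hsub with h6 | h6
  · rw [h6, Finset.prod_empty] at hprod
    exact ⟨b, Or.inl (by rw [← hab, ← hprod, mul_one])⟩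
  · rw [h6, Finset.prod_singleton] at hprod
    exact ⟨b, Or.inr (by rw [← hab, ← hprod, mul_comm])⟩

theorem summable_indRest : Summable fun n : ℕ => indRest n * (n : ℝ) ^ (-(3 / 4) : ℝ) := by
  have aux : ∀ φ : ℕ → ℕ, Function.Injective φ → (∀ c, c ^ 2 ≤ φ c) → (∀ c, c ≠ 0 → φ c ≠ 0) →
      φ 0 = 0 →
      Summable ((Set.range φ).indicator fun n : ℕ => (n : ℝ) ^ (-(3 / 4) : ℝ)) := by
    intro φ hφ hle hne h0
    rw [← hφ.summable_iff fun x hx => Set.indicator_of_notMem hx _]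
    refine Summable.of_nonneg_of_le (fun c => ?_)
      (fun c => ?_) (Real.summable_nat_rpow.2 (by norm_num : (-(3 / 2) : ℝ) < -1))
    · rw [Function.comp_apply]
      exact Set.indicator_nonneg (fun n _ => by positivity) _
    rw [Function.comp_apply, Set.indicator_of_mem (Set.mem_range_self c)]
    rcases eq_or_ne c 0 with rfl | hc
    · simp [h0, Real.zero_rpow]
    · have hc0 : 0 < (c : ℝ) := by exact_mod_cast Nat.pos_of_ne_zero hc
      have : (c : ℝ) ^ (-(3 / 2) : ℝ) = ((c : ℝ) ^ 2) ^ (-(3 / 4) : ℝ) := by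
        rw [← Real.rpow_natCast, ← Real.rpow_mul hc0.le]; norm_num
      rw [this]
      exact Real.rpow_le_rpow_of_nonpos (by positivity) (by exact_mod_cast hle c) (by norm_num)
  have h1 := aux (fun c => c ^ 2) (Nat.pow_left_injective two_ne_zero) (fun c => le_rfl)
    (fun c hc => by positivity) (by simp)
  have h2 := aux (fun c => 2 * c ^ 2)
    (fun a b hab => Nat.pow_left_injective two_ne_zero (by simpa using hab)) (fun c => by
      show c ^ 2 ≤ 2 * c ^ 2
      omega) (fun c hc => by positivity) (by simp)
  refine Summable.of_nonneg_of_le (fun n => mul_nonneg (indRest_nonneg n) (by positivity))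
    (fun n => ?_) (h1.add h2)
  have hpos : 0 ≤ (n : ℝ) ^ (-(3 / 4) : ℝ) := by positivity
  have hn1 : ∀ s : Set ℕ, 0 ≤ s.indicator (fun n : ℕ => (n : ℝ) ^ (-(3 / 4) : ℝ)) n := fun s =>
    Set.indicator_nonneg (fun n _ => by positivity) _
  by_cases h : indRest n = 0
  · rw [h, zero_mul]
    exact add_nonneg (hn1 _) (hn1 _)
  · have hle : indRest n * (n : ℝ) ^ (-(3 / 4) : ℝ) ≤ (n : ℝ) ^ (-(3 / 4) : ℝ) :=
      mul_le_of_le_one_left hpos ((indRest_le_indS n).trans (indS_le_one n))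
    refine hle.trans ?_
    obtain ⟨c, hc | hc⟩ := exists_sq_of_indRest_ne_zero h
    · have hmem : n ∈ Set.range fun c : ℕ => c ^ 2 := ⟨c, hc.symm⟩
      refine le_add_of_le_of_nonneg ?_ (hn1 _)
      rw [Set.indicator_of_mem hmem]
    · have hmem : n ∈ Set.range fun c : ℕ => 2 * c ^ 2 := ⟨c, hc.symm⟩
      refine le_add_of_nonneg_of_le (hn1 _) ?_
      rw [Set.indicator_of_mem hmem]

theorem mulLog_nonneg {a : ArithmeticFunction ℝ} (ha : ∀ n, 0 ≤ a n) (n : ℕ) : 0 ≤ mulLog a n :=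
  mul_nonneg (ha n) (Real.log_natCast_nonneg n)

/-- The exponent moves from `3/4` to `7/8` to absorb the logarithm, through `log n ≤ 8 n^(1/8)`. -/
theorem summable_mulLog_indRest :
    Summable fun n : ℕ => mulLog indRest n * (n : ℝ) ^ (-(7 / 8) : ℝ) := by
  refine Summable.of_nonneg_of_le
    (fun n => mul_nonneg (mulLog_nonneg indRest_nonneg n) (by positivity)) (fun n => ?_)
    (summable_indRest.mul_left 8)
  rcases Nat.eq_zero_or_pos n with rfl | hn
  · simp
  have hn0 : 0 < (n : ℝ) := by exact_mod_cast hn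
  have h1 := Real.log_le_rpow_div hn0.le (by norm_num : (0 : ℝ) < 1 / 8)
  have h2 : (n : ℝ) ^ (-(3 / 4) : ℝ) = (n : ℝ) ^ (1 / 8 : ℝ) * (n : ℝ) ^ (-(7 / 8) : ℝ) := by
    rw [← Real.rpow_add hn0]; norm_num
  rw [h2, mulLog_apply]
  have h3 : Real.log n ≤ 8 * (n : ℝ) ^ (1 / 8 : ℝ) := by linarith
  calc indRest n * Real.log n * (n : ℝ) ^ (-(7 / 8) : ℝ)
      ≤ indRest n * (8 * (n : ℝ) ^ (1 / 8 : ℝ)) * (n : ℝ) ^ (-(7 / 8) : ℝ) := by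
        gcongr
        exact indRest_nonneg n
    _ = _ := by ring

/-! ### Convolution with sparse functions -/

/-- The function `√(1 + log x)`, whose reciprocal is the order of magnitude of the density of the
sums of two squares near `x`. -/
noncomputable def sqrtLog (x : ℝ) : ℝ := √(1 + Real.log x)

theorem one_le_sqrtLog {x : ℝ} (hx : 1 ≤ x) : 1 ≤ sqrtLog x :=
  Real.one_le_sqrt.2 (by linarith [Real.log_nonneg hx])

theorem sqrtLog_pos {x : ℝ} (hx : 1 ≤ x) : 0 < sqrtLog x := one_pos.trans_le (one_le_sqrtLog hx)

theorem sqrtLog_sq {x : ℝ} (hx : 1 ≤ x) : sqrtLog x ^ 2 = 1 + Real.log x :=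
  Real.sq_sqrt (by linarith [Real.log_nonneg hx])

theorem sqrtLog_mono {x y : ℝ} (hx : 1 ≤ x) (hxy : x ≤ y) : sqrtLog x ≤ sqrtLog y :=
  Real.sqrt_le_sqrt (by linarith [Real.log_le_log (by linarith) hxy])

theorem sqrtLog_mul_le {x y : ℝ} (hx : 1 ≤ x) (hy : 1 ≤ y) :
    sqrtLog (x * y) ≤ sqrtLog x * sqrtLog y := by
  have h1 := Real.log_nonneg hx
  have h2 := Real.log_nonneg hy
  rw [sqrtLog, sqrtLog, sqrtLog, ← Real.sqrt_mul (by linarith),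
    Real.log_mul (by linarith) (by linarith)]
  exact Real.sqrt_le_sqrt (by nlinarith)

theorem sqrtLog_le_rpow {x : ℝ} (hx : 1 ≤ x) : sqrtLog x ≤ 9 * x ^ (1 / 8 : ℝ) := by
  have h0 := Real.log_nonneg hx
  have h1 := Real.log_le_rpow_div (by linarith : 0 ≤ x) (by norm_num : (0 : ℝ) < 1 / 8)
  have h2 : 1 ≤ x ^ (1 / 8 : ℝ) := Real.one_le_rpow hx (by norm_num)
  have h3 : sqrtLog x ≤ 1 + Real.log x := (Real.sqrt_le_left (by linarith)).2 (by nlinarith)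
  linarith

/-- Submultiplicativity of `sqrtLog` bounds `(x/n)/sqrtLog (x/n)` by `9 n^(-7/8) · x/sqrtLog x`.
Hence convolving with a sparse `c` preserves the order `x/√(log x)`. -/
theorem exists_sum_mul_le_div_sqrtLog {c : ℕ → ℝ} (hc : ∀ n, 0 ≤ c n)
    (hs : Summable fun n : ℕ => c n * (n : ℝ) ^ (-(7 / 8) : ℝ)) {D : ℝ → ℝ} {B : ℝ} (hB : 0 < B)
    (hD : ∀ t, 1 ≤ t → D t ≤ B * (t / sqrtLog t)) :
    ∃ C : ℝ, 0 < C ∧ ∀ x : ℝ, 1 ≤ x →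
      ∑ n ∈ Finset.Ioc 0 ⌊x⌋₊, c n * D (x / n) ≤ C * (x / sqrtLog x) := by
  set Z := ∑' n : ℕ, c n * (n : ℝ) ^ (-(7 / 8) : ℝ)
  have hZ : 0 ≤ Z := tsum_nonneg fun n => mul_nonneg (hc n) (by positivity)
  refine ⟨9 * B * (Z + 1), by positivity, fun x hx => ?_⟩
  have hx0 : 0 < x := by linarith
  have hsx := sqrtLog_pos hx
  have hterm : ∀ n ∈ Finset.Ioc 0 ⌊x⌋₊, c n * D (x / n) ≤
      9 * B * (x / sqrtLog x) * (c n * (n : ℝ) ^ (-(7 / 8) : ℝ)) := by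
    intro n hn
    obtain ⟨hn1, hnx⟩ := mem_Ioc_floor hn
    have hn0 : 0 < (n : ℝ) := by linarith
    have hxn : 1 ≤ x / n := (one_le_div hn0).2 hnx
    have h1 : sqrtLog x ≤ sqrtLog (x / n) * (9 * (n : ℝ) ^ (1 / 8 : ℝ)) := by
      calc sqrtLog x = sqrtLog (x / n * n) := by rw [div_mul_cancel₀ _ hn0.ne']
        _ ≤ sqrtLog (x / n) * sqrtLog n := sqrtLog_mul_le hxn hn1
        _ ≤ _ := mul_le_mul_of_nonneg_left (sqrtLog_le_rpow hn1) (sqrtLog_pos hxn).le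
    have h2 : (x / n) / sqrtLog (x / n) ≤
        9 * (x / sqrtLog x) * (n : ℝ) ^ (-(7 / 8) : ℝ) := by
      have h3 : (n : ℝ) ^ (-(7 / 8) : ℝ) = (n : ℝ) ^ (1 / 8 : ℝ) / n := by
        rw [← Real.rpow_sub_one hn0.ne']; norm_num
      rw [h3, div_le_iff₀ (sqrtLog_pos hxn)]
      have h4 : 9 * (x / sqrtLog x) * ((n : ℝ) ^ (1 / 8 : ℝ) / n) * sqrtLog (x / n) =
          x / n * (sqrtLog (x / n) * (9 * (n : ℝ) ^ (1 / 8 : ℝ)) / sqrtLog x) := by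
        ring
      rw [h4]
      refine le_mul_of_one_le_right (by positivity) ?_
      rwa [one_le_div hsx]
    calc c n * D (x / n) ≤ c n * (B * (9 * (x / sqrtLog x) * (n : ℝ) ^ (-(7 / 8) : ℝ))) := by
          refine mul_le_mul_of_nonneg_left ((hD _ hxn).trans ?_) (hc n)
          exact mul_le_mul_of_nonneg_left h2 hB.le
      _ = _ := by ring
  refine (Finset.sum_le_sum hterm).trans ?_
  rw [← Finset.mul_sum]
  have h1 : ∑ n ∈ Finset.Ioc 0 ⌊x⌋₊, c n * (n : ℝ) ^ (-(7 / 8) : ℝ) ≤ Z :=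
    hs.sum_le_tsum _ fun n _ => mul_nonneg (hc n) (by positivity)
  calc 9 * B * (x / sqrtLog x) * ∑ n ∈ Finset.Ioc 0 ⌊x⌋₊, c n * (n : ℝ) ^ (-(7 / 8) : ℝ)
      ≤ 9 * B * (x / sqrtLog x) * (Z + 1) := by gcongr; linarith
    _ = _ := by ring

theorem exists_sum_mul_le_self {c : ℕ → ℝ} (hc : ∀ n, 0 ≤ c n)
    (hs : Summable fun n : ℕ => c n * (n : ℝ) ^ (-(7 / 8) : ℝ)) {D : ℝ → ℝ} {B : ℝ} (hB : 0 < B)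
    (hD : ∀ t, 1 ≤ t → D t ≤ B * t) :
    ∃ C : ℝ, 0 < C ∧ ∀ x : ℝ, 1 ≤ x → ∑ n ∈ Finset.Ioc 0 ⌊x⌋₊, c n * D (x / n) ≤ C * x := by
  set Z := ∑' n : ℕ, c n * (n : ℝ) ^ (-(7 / 8) : ℝ)
  have hZ : 0 ≤ Z := tsum_nonneg fun n => mul_nonneg (hc n) (by positivity)
  refine ⟨B * (Z + 1), by positivity, fun x hx => ?_⟩
  have hx0 : 0 < x := by linarith
  have hterm : ∀ n ∈ Finset.Ioc 0 ⌊x⌋₊, c n * D (x / n) ≤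
      B * x * (c n * (n : ℝ) ^ (-(7 / 8) : ℝ)) := by
    intro n hn
    obtain ⟨hn1, hnx⟩ := mem_Ioc_floor hn
    have hn0 : 0 < (n : ℝ) := by linarith
    have h2 : x / n ≤ x * (n : ℝ) ^ (-(7 / 8) : ℝ) := by
      rw [div_eq_mul_inv, ← Real.rpow_neg_one]
      exact mul_le_mul_of_nonneg_left
        (Real.rpow_le_rpow_of_exponent_le hn1 (by norm_num)) hx0.le
    calc c n * D (x / n) ≤ c n * (B * (x * (n : ℝ) ^ (-(7 / 8) : ℝ))) := by
          refine mul_le_mul_of_nonneg_left ((hD _ ((one_le_div hn0).2 hnx)).trans ?_) (hc n)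
          exact mul_le_mul_of_nonneg_left h2 hB.le
      _ = _ := by ring
  refine (Finset.sum_le_sum hterm).trans ?_
  rw [← Finset.mul_sum]
  have h1 : ∑ n ∈ Finset.Ioc 0 ⌊x⌋₊, c n * (n : ℝ) ^ (-(7 / 8) : ℝ) ≤ Z :=
    hs.sum_le_tsum _ fun n _ => mul_nonneg (hc n) (by positivity)
  calc B * x * ∑ n ∈ Finset.Ioc 0 ⌊x⌋₊, c n * (n : ℝ) ^ (-(7 / 8) : ℝ)
      ≤ B * x * (Z + 1) := by gcongr; linarith
    _ = _ := by ring

/-- The function `n ↦ n ^ (-1/4)`. -/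
noncomputable def invFourthRoot : ArithmeticFunction ℝ :=
  ⟨fun n => (n : ℝ) ^ (-(1 / 4) : ℝ), by simp [Real.zero_rpow]⟩

theorem invFourthRoot_apply (n : ℕ) : invFourthRoot n = (n : ℝ) ^ (-(1 / 4) : ℝ) := rfl

theorem invFourthRoot_nonneg (n : ℕ) : 0 ≤ invFourthRoot n := by
  rw [invFourthRoot_apply]; positivity

theorem summable_invFourthRoot :
    Summable fun n : ℕ => invFourthRoot n * (n : ℝ) ^ (-(7 / 8) : ℝ) := by
  refine (Real.summable_nat_rpow.2 (by norm_num : (-(9 / 8) : ℝ) < -1)).congr fun n => ?_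
  rcases Nat.eq_zero_or_pos n with rfl | hn
  · simp [Real.zero_rpow]
  · rw [invFourthRoot_apply, ← Real.rpow_add (by exact_mod_cast hn)]
    norm_num

theorem rpow_le_partialSum_invFourthRoot {t : ℝ} (ht : 1 ≤ t) :
    t ^ (3 / 4 : ℝ) ≤ 2 * partialSum invFourthRoot t := by
  have ht0 : 0 < t := by linarith
  have h1 : (⌊t⌋₊ : ℝ) * t ^ (-(1 / 4) : ℝ) ≤ partialSum invFourthRoot t := by
    have := Finset.card_nsmul_le_sum (Finset.Ioc 0 ⌊t⌋₊) (fun n => invFourthRoot n)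
      (t ^ (-(1 / 4) : ℝ)) fun n hn => by
        obtain ⟨hn1, hnt⟩ := mem_Ioc_floor hn
        exact Real.rpow_le_rpow_of_nonpos (by linarith) hnt (by norm_num)
    simpa [partialSum] using this
  have h2 : t ≤ 2 * ⌊t⌋₊ := by
    have h3 := Nat.lt_floor_add_one t
    have h4 : (1 : ℝ) ≤ ⌊t⌋₊ := by exact_mod_cast (Nat.one_le_floor_iff t).2 ht
    linarith
  have h3 : t ^ (3 / 4 : ℝ) = t * t ^ (-(1 / 4) : ℝ) := by
    rw [mul_comm, ← Real.rpow_add_one ht0.ne']; norm_num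
  rw [h3]
  have h4 : t * t ^ (-(1 / 4) : ℝ) ≤ 2 * ⌊t⌋₊ * t ^ (-(1 / 4) : ℝ) :=
    mul_le_mul_of_nonneg_right h2 (by positivity)
  linarith

theorem sum_mul_rpow_le {a : ArithmeticFunction ℝ} (ha : ∀ n, 0 ≤ a n) (x : ℝ) :
    ∑ d ∈ Finset.Ioc 0 ⌊x⌋₊, a d * (x / d) ^ (3 / 4 : ℝ) ≤
      2 * ∑ m ∈ Finset.Ioc 0 ⌊x⌋₊, invFourthRoot m * partialSum a (x / m) := by
  rw [← partialSum_mul, mul_comm invFourthRoot, partialSum_mul, Finset.mul_sum]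
  refine Finset.sum_le_sum fun d hd => ?_
  obtain ⟨hd1, hdx⟩ := mem_Ioc_floor hd
  have h := rpow_le_partialSum_invFourthRoot ((one_le_div (by linarith)).2 hdx)
  have := mul_le_mul_of_nonneg_left h (ha d)
  linarith

theorem exists_sum_mul_rpow_le_div_sqrtLog {a : ArithmeticFunction ℝ} (ha : ∀ n, 0 ≤ a n) {B : ℝ}
    (hB : 0 < B) (h : ∀ t, 1 ≤ t → partialSum a t ≤ B * (t / sqrtLog t)) :
    ∃ C : ℝ, 0 < C ∧ ∀ x : ℝ, 1 ≤ x →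
      ∑ d ∈ Finset.Ioc 0 ⌊x⌋₊, a d * (x / d) ^ (3 / 4 : ℝ) ≤ C * (x / sqrtLog x) := by
  obtain ⟨C, hC, hle⟩ := exists_sum_mul_le_div_sqrtLog invFourthRoot_nonneg summable_invFourthRoot
    hB h
  refine ⟨2 * C, by positivity, fun x hx => (sum_mul_rpow_le ha x).trans ?_⟩
  have := hle x hx
  linarith

theorem exists_sum_mul_rpow_le_self {a : ArithmeticFunction ℝ} (ha : ∀ n, 0 ≤ a n) {B : ℝ}
    (hB : 0 < B) (h : ∀ t, 1 ≤ t → partialSum a t ≤ B * t) :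
    ∃ C : ℝ, 0 < C ∧ ∀ x : ℝ, 1 ≤ x →
      ∑ d ∈ Finset.Ioc 0 ⌊x⌋₊, a d * (x / d) ^ (3 / 4 : ℝ) ≤ C * x := by
  obtain ⟨C, hC, hle⟩ := exists_sum_mul_le_self invFourthRoot_nonneg summable_invFourthRoot hB h
  refine ⟨2 * C, by positivity, fun x hx => (sum_mul_rpow_le ha x).trans ?_⟩
  have := hle x hx
  linarith

/-! ### Mertens' theorem for the primes `1 mod 4` -/

theorem mangoldtOne_nonneg (n : ℕ) : 0 ≤ mangoldtOne n :=
  mul_nonneg (indOne_nonneg n) vonMangoldt_nonneg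

theorem mangoldtOne_le (n : ℕ) : mangoldtOne n ≤ vonMangoldt n :=
  mul_le_of_le_one_left vonMangoldt_nonneg (indOne_le_one n)

theorem partialSum_mangoldtOne_le {t : ℝ} (ht : 0 ≤ t) :
    partialSum mangoldtOne t ≤ (Real.log 4 + 4) * t :=
  (Finset.sum_le_sum fun n _ => mangoldtOne_le n).trans (Chebyshev.psi_le_const_mul_self ht)

theorem partialSum_indOne_mul_indOne_le (t : ℝ) :
    partialSum ⇑(indOne * indOne) t ≤ partialSum rep t := by
  refine Finset.sum_le_sum fun n _ => ?_
  rw [← indS_mul_indOne, mul_apply, mul_apply]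
  exact Finset.sum_le_sum fun d _ =>
    mul_le_mul_of_nonneg_right (indOne_le_indS _) (indOne_nonneg _)

/-- Sum `mulLog_rep` up to `x` and write `A` for `repMean`. The left side is `A x log x + O(x)`; the
right is `2 A x ∑ mangoldtOne d / d + O(x)`, where Chebyshev's bound controls the error of replacing
`partialSum rep` by its main term. Divide by `2 A x`. -/
theorem exists_abs_sum_mangoldtOne_div_sub_le :
    ∃ C : ℝ, 0 < C ∧ ∀ x : ℝ, 1 ≤ x →
      |∑ d ∈ Finset.Ioc 0 ⌊x⌋₊, mangoldtOne d / d - Real.log x / 2| ≤ C := by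
  obtain ⟨C₁, hC₁, h₁⟩ := exists_abs_partialSum_mulLog_rep_sub_le
  obtain ⟨C₂, hC₂, h₂⟩ := exists_abs_partialSum_rep_sub_le_rpow
  obtain ⟨C₃, hC₃, h₃⟩ := exists_partialSum_rep_le
  obtain ⟨C₄, hC₄, h₄⟩ := exists_sum_mul_rpow_le_self mangoldtOne_nonneg
    (by positivity : 0 < Real.log 4 + 4)
    fun t ht => partialSum_mangoldtOne_le (by linarith)
  obtain ⟨C₅, hC₅, h₅⟩ := exists_sum_mul_le_self (mulLog_nonneg indRest_nonneg)
    summable_mulLog_indRest hC₃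
    fun t ht => (partialSum_indOne_mul_indOne_le t).trans (h₃ t ht)
  have hA := repMean_pos
  refine ⟨(C₁ + repMean + 2 * (C₂ * C₄) + C₅) / (2 * repMean), by positivity, fun x hx => ?_⟩
  have hx0 : 0 < x := by linarith
  have hid : partialSum (mulLog rep) x =
      2 * ∑ d ∈ Finset.Ioc 0 ⌊x⌋₊, mangoldtOne d * partialSum rep (x / d) +
      ∑ b ∈ Finset.Ioc 0 ⌊x⌋₊, mulLog indRest b * partialSum ⇑(indOne * indOne) (x / b) := by
    rw [← partialSum_mul, ← partialSum_mul, mulLog_rep, two_mul, mul_comm mangoldtOne rep]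
    simp only [partialSum, ArithmeticFunction.add_apply, Finset.sum_add_distrib]
    ring
  set L := ∑ d ∈ Finset.Ioc 0 ⌊x⌋₊, mangoldtOne d / d with hL
  have hmain : |∑ d ∈ Finset.Ioc 0 ⌊x⌋₊, mangoldtOne d * partialSum rep (x / d) -
      repMean * x * L| ≤ C₂ * (C₄ * x) := by
    rw [hL, Finset.mul_sum, ← Finset.sum_sub_distrib]
    refine (Finset.abs_sum_le_sum_abs _ _).trans ?_
    refine le_trans ?_ (mul_le_mul_of_nonneg_left (h₄ x hx) hC₂.le)
    rw [Finset.mul_sum]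
    refine Finset.sum_le_sum fun d hd => ?_
    obtain ⟨hd1, hdx⟩ := mem_Ioc_floor hd
    have h6 := h₂ (x / d) ((one_le_div (by linarith)).2 hdx)
    have h7 : mangoldtOne d * partialSum rep (x / d) - repMean * x * (mangoldtOne d / d) =
        mangoldtOne d * (partialSum rep (x / d) - repMean * (x / d)) := by ring
    rw [h7, abs_mul, abs_of_nonneg (mangoldtOne_nonneg d)]
    have := mul_le_mul_of_nonneg_left h6 (mangoldtOne_nonneg d)
    linarith
  have hrest0 : 0 ≤ ∑ b ∈ Finset.Ioc 0 ⌊x⌋₊,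
      mulLog indRest b * partialSum ⇑(indOne * indOne) (x / b) := by
    refine Finset.sum_nonneg fun b _ => mul_nonneg (mulLog_nonneg indRest_nonneg b)
      (partialSum_nonneg (fun n => ?_) _)
    rw [mul_apply]
    exact Finset.sum_nonneg fun d _ => mul_nonneg (indOne_nonneg _) (indOne_nonneg _)
  have hrest := h₅ x hx
  have h8 := h₁ x hx
  have h9 : x ^ (3 / 4 : ℝ) ≤ x := by
    simpa using Real.rpow_le_rpow_of_exponent_le hx (by norm_num : (3 / 4 : ℝ) ≤ 1)
  have h10 : C₁ * x ^ (3 / 4 : ℝ) ≤ C₁ * x := mul_le_mul_of_nonneg_left h9 hC₁.le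
  have h11 : 0 < repMean * x := by positivity
  have h12 : |(2 * repMean * x) * (L - Real.log x / 2)| ≤
      (C₁ + repMean + 2 * (C₂ * C₄) + C₅) * x := by
    rw [abs_le] at hmain h8 ⊢
    constructor <;> linarith [hmain.1, hmain.2, h8.1, h8.2]
  rw [abs_mul, abs_of_pos (by positivity)] at h12
  rw [le_div_iff₀ (by positivity)]
  refine le_of_mul_le_mul_right ?_ hx0
  linarith

/-- The primes `p ≡ 1 mod 4` with `p ≤ z`. -/
noncomputable def primesOne (z : ℝ) : Finset ℕ := {p ∈ Finset.Ioc 0 ⌊z⌋₊ | p.Prime ∧ p % 4 = 1}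

theorem mem_primesOne {z : ℝ} {p : ℕ} :
    p ∈ primesOne z ↔ p.Prime ∧ p % 4 = 1 ∧ (p : ℝ) ≤ z := by
  rw [primesOne, Finset.mem_filter, Finset.mem_Ioc]
  constructor
  · rintro ⟨⟨h1, h2⟩, h3, h4⟩
    exact ⟨h3, h4, (Nat.le_floor_iff' (by omega)).1 h2⟩
  · rintro ⟨h1, h2, h3⟩
    exact ⟨⟨h1.pos, Nat.le_floor h3⟩, h1, h2⟩

/-- `log p / p` on the primes `p ≡ 1 mod 4`. -/
noncomputable def logDivPrime (n : ℕ) : ℝ :=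
  if n.Prime ∧ n % 4 = 1 then Real.log n / n else 0

theorem partialSum_logDivPrime (z : ℝ) :
    partialSum logDivPrime z = ∑ p ∈ primesOne z, Real.log p / p := by
  rw [partialSum, primesOne, Finset.sum_filter]
  rfl

theorem summable_vonMangoldt_div_not_prime :
    Summable fun n : ℕ => (if n.Prime then 0 else vonMangoldt n) / n := by
  -- Modulo `1` there is a single residue class, so the restriction to it is void.
  refine (vonMangoldt.summable_residueClass_non_primes_div (0 : ZMod 1)).congr fun n => ?_
  have h : vonMangoldt.residueClass (0 : ZMod 1) n = vonMangoldt n :=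
    Set.indicator_of_mem (s := {n : ℕ | (n : ZMod 1) = 0}) (Subsingleton.elim (n : ZMod 1) 0) _
  rw [h]

theorem exists_abs_partialSum_logDivPrime_sub_le :
    ∃ C : ℝ, 0 < C ∧ ∀ z : ℝ, 1 ≤ z → |partialSum logDivPrime z - Real.log z / 2| ≤ C := by
  obtain ⟨C, hC, h⟩ := exists_abs_sum_mangoldtOne_div_sub_le
  have hs := summable_vonMangoldt_div_not_prime
  set Z := ∑' n : ℕ, (if n.Prime then 0 else vonMangoldt n) / (n : ℝ)
  have hnn : ∀ n : ℕ, 0 ≤ (if n.Prime then 0 else vonMangoldt n) / (n : ℝ) := fun n => by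
    split_ifs
    · simp
    · exact div_nonneg vonMangoldt_nonneg (by positivity)
  have hZ : 0 ≤ Z := tsum_nonneg hnn
  refine ⟨C + Z, by positivity, fun z hz => ?_⟩
  have hdiff : ∀ n : ℕ, 0 ≤ mangoldtOne n / n - logDivPrime n ∧
      mangoldtOne n / n - logDivPrime n ≤ (if n.Prime then 0 else vonMangoldt n) / (n : ℝ) := by
    intro n
    by_cases hp : n.Prime
    · have h1 : mangoldtOne n = (if n % 4 = 1 then 1 else 0) * Real.log n := by
        rw [mangoldtOne, pmul_apply, vonMangoldt_apply_prime hp]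
        have := indOne_prime_pow hp 1
        rw [pow_one] at this
        simp [this]
      have h2 : mangoldtOne n / n - logDivPrime n = 0 := by
        rw [h1, logDivPrime]
        simp only [hp, true_and]
        split_ifs <;> simp
      rw [h2, if_pos hp]
      simp
    · rw [if_neg hp, logDivPrime, if_neg (fun h => hp h.1), sub_zero]
      exact ⟨div_nonneg (mangoldtOne_nonneg n) (by positivity),
        div_le_div_of_nonneg_right (mangoldtOne_le n) (by positivity)⟩
  have h1 : 0 ≤ ∑ n ∈ Finset.Ioc 0 ⌊z⌋₊, (mangoldtOne n / n - logDivPrime n) :=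
    Finset.sum_nonneg fun n _ => (hdiff n).1
  have h2 : ∑ n ∈ Finset.Ioc 0 ⌊z⌋₊, (mangoldtOne n / n - logDivPrime n) ≤ Z :=
    (Finset.sum_le_sum fun n _ => (hdiff n).2).trans (hs.sum_le_tsum _ fun n _ => hnn n)
  rw [Finset.sum_sub_distrib] at h1 h2
  have h3 := h z hz
  rw [partialSum]
  rw [abs_le] at h3 ⊢
  constructor <;> linarith [h3.1, h3.2]

theorem exists_abs_sum_inv_primesOne_sub_le :
    ∃ C : ℝ, 0 < C ∧ ∀ z : ℝ, 2 ≤ z →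
      |∑ p ∈ primesOne z, 1 / (p : ℝ) - Real.log (Real.log z) / 2| ≤ C := by
  obtain ⟨C, hC, h⟩ := exists_abs_partialSum_logDivPrime_sub_le
  have hl2 : 0 < Real.log 2 := Real.log_pos (by norm_num)
  -- Partial summation with weight `1/log t` from `2`: the boundary term gives `1/2 + C/log 2`, the
  -- error integral of `C/(t log² t)` gives `C/log 2`, and the main integral of `1/(2 t log t)`
  -- leaves `log log 2 / 2` at its lower limit.
  refine ⟨1 / 2 + C / Real.log 2 + C / Real.log 2 + |Real.log (Real.log 2)| / 2,
    by positivity, fun z hz => ?_⟩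
  have hlt : ∀ t ∈ Set.Icc 2 z, 0 < t ∧ 0 < Real.log t := fun t ht =>
    ⟨by linarith [ht.1], Real.log_pos (by linarith [ht.1])⟩
  have hd : ∀ t ∈ Set.Icc 2 z, HasDerivAt (fun t => (Real.log t)⁻¹) (-t⁻¹ / Real.log t ^ 2) t :=
    fun t ht => (Real.hasDerivAt_log (hlt t ht).1.ne').inv (hlt t ht).2.ne'
  have hderiv : Set.EqOn (deriv fun t => (Real.log t)⁻¹) (fun t => -t⁻¹ / Real.log t ^ 2)
      (Set.Icc 2 z) := fun t ht => (hd t ht).deriv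
  have hclog : ContinuousOn Real.log (Set.Icc 2 z) :=
    Real.continuousOn_log.mono fun t ht => (hlt t ht).1.ne'
  have hcinv : ContinuousOn (fun t : ℝ => t⁻¹) (Set.Icc 2 z) :=
    continuousOn_inv₀.mono fun t ht => (hlt t ht).1.ne'
  have hint0 : ContinuousOn (fun t => t⁻¹ / Real.log t ^ 2) (Set.Icc 2 z) :=
    hcinv.div (hclog.pow 2) fun t ht => (pow_pos (hlt t ht).2 2).ne'
  have hint1 : ContinuousOn (fun t => t⁻¹ / Real.log t) (Set.Icc 2 z) :=
    hcinv.div hclog fun t ht => (hlt t ht).2.ne'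
  have hint2 : MeasureTheory.IntegrableOn (fun t => -t⁻¹ / Real.log t ^ 2) (Set.Icc 2 z) := by
    simpa [neg_div] using hint0.integrableOn_Icc.neg
  have hc0 : logDivPrime 0 = 0 := by simp [logDivPrime]
  have hc1 : logDivPrime 1 = 0 := by simp [logDivPrime]
  have habel := sum_mul_eq_sub_integral_mul₁ logDivPrime hc0 hc1 z
    (fun t ht => (hd t ht).differentiableAt) (hint2.congr_fun hderiv.symm measurableSet_Icc)
  rw [sum_Icc_zero_eq (by simp [hc0]), sum_Icc_zero_eq hc0] at habel
  have hlhs : ∑ p ∈ primesOne z, 1 / (p : ℝ) =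
      ∑ n ∈ Finset.Ioc 0 ⌊z⌋₊, (Real.log n)⁻¹ * logDivPrime n := by
    rw [primesOne, Finset.sum_filter]
    refine Finset.sum_congr rfl fun n _ => ?_
    rw [logDivPrime]
    split_ifs with hn
    · have h1 : Real.log n ≠ 0 := (Real.log_pos (by exact_mod_cast hn.1.one_lt)).ne'
      field_simp
    · simp
  have hintP : IntervalIntegrable (fun t => t⁻¹ / Real.log t ^ 2 * partialSum logDivPrime t)
      MeasureTheory.volume 2 z := by
    rw [intervalIntegrable_iff_integrableOn_Icc_of_le hz]
    exact integrableOn_mul_sum_Icc (m := 1) logDivPrime (by norm_num) hint0.integrableOn_Icc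
  have hintM : IntervalIntegrable (fun t => t⁻¹ / Real.log t) MeasureTheory.volume 2 z := by
    refine ContinuousOn.intervalIntegrable ?_
    rwa [Set.uIcc_of_le hz]
  have hint3 : IntervalIntegrable (fun t => t⁻¹ / Real.log t ^ 2) MeasureTheory.volume 2 z := by
    refine ContinuousOn.intervalIntegrable ?_
    rwa [Set.uIcc_of_le hz]
  have hrhs : -∫ t in Set.Ioc 2 z, deriv (fun t => (Real.log t)⁻¹) t *
      ∑ k ∈ Finset.Icc 0 ⌊t⌋₊, logDivPrime k =
      ∫ t in (2 : ℝ)..z, t⁻¹ / Real.log t ^ 2 * partialSum logDivPrime t := by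
    rw [← MeasureTheory.integral_neg, intervalIntegral.integral_of_le hz]
    refine MeasureTheory.setIntegral_congr_fun measurableSet_Ioc fun t ht => ?_
    have h1 := hderiv (Set.Ioc_subset_Icc_self ht)
    simp only at h1 ⊢
    rw [h1, sum_Icc_zero_eq hc0, partialSum]
    ring
  have hm : ∫ t in (2 : ℝ)..z, t⁻¹ / Real.log t = Real.log (Real.log z) - Real.log (Real.log 2) := by
    refine intervalIntegral.integral_eq_sub_of_hasDerivAt
      (f := fun t => Real.log (Real.log t)) (fun t ht => ?_) hintM
    rw [Set.uIcc_of_le hz] at ht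
    exact (Real.hasDerivAt_log (hlt t ht).1.ne').log (hlt t ht).2.ne'
  have he : ∫ t in (2 : ℝ)..z, t⁻¹ / Real.log t ^ 2 = -(Real.log z)⁻¹ - -(Real.log 2)⁻¹ := by
    refine intervalIntegral.integral_eq_sub_of_hasDerivAt
      (f := fun t => -(Real.log t)⁻¹) (fun t ht => ?_) hint3
    rw [Set.uIcc_of_le hz] at ht
    have := (hd t ht).neg
    rwa [← neg_div, neg_neg] at this
  have hbound : |(∫ t in (2 : ℝ)..z, t⁻¹ / Real.log t ^ 2 * partialSum logDivPrime t) -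
      1 / 2 * ∫ t in (2 : ℝ)..z, t⁻¹ / Real.log t| ≤ C * (Real.log 2)⁻¹ := by
    rw [← intervalIntegral.integral_const_mul, ← intervalIntegral.integral_sub hintP
      (hintM.const_mul _), ← Real.norm_eq_abs]
    have h1 : C * ∫ t in (2 : ℝ)..z, t⁻¹ / Real.log t ^ 2 ≤ C * (Real.log 2)⁻¹ := by
      rw [he]
      refine mul_le_mul_of_nonneg_left ?_ hC.le
      have : 0 ≤ (Real.log z)⁻¹ := inv_nonneg.2 (Real.log_nonneg (by linarith))
      linarith
    rw [← intervalIntegral.integral_const_mul] at h1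
    refine le_trans ?_ h1
    refine intervalIntegral.norm_integral_le_of_norm_le hz ?_ (hint3.const_mul _)
    refine Filter.Eventually.of_forall fun t ht => ?_
    obtain ⟨ht0, htl⟩ := hlt t (Set.Ioc_subset_Icc_self ht)
    have h2 : t⁻¹ / Real.log t ^ 2 * partialSum logDivPrime t - 1 / 2 * (t⁻¹ / Real.log t) =
        t⁻¹ / Real.log t ^ 2 * (partialSum logDivPrime t - Real.log t / 2) := by
      field_simp
    rw [h2, Real.norm_eq_abs, abs_mul, abs_of_pos (by positivity), mul_comm C]
    exact mul_le_mul_of_nonneg_left (h t (by linarith [ht.1])) (by positivity)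
  have hzl := (hlt z ⟨hz, le_rfl⟩).2
  have hfirst : |(Real.log z)⁻¹ * partialSum logDivPrime z| ≤ 1 / 2 + C / Real.log 2 := by
    have h1 := h z (by linarith)
    have h2 : |partialSum logDivPrime z| ≤ Real.log z / 2 + C := by
      rw [abs_le] at h1 ⊢
      constructor <;> linarith [h1.1, h1.2]
    rw [abs_mul, abs_of_pos (inv_pos.2 hzl)]
    calc (Real.log z)⁻¹ * |partialSum logDivPrime z|
        ≤ (Real.log z)⁻¹ * (Real.log z / 2 + C) := by gcongr
      _ = 1 / 2 + C / Real.log z := by field_simp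
      _ ≤ 1 / 2 + C / Real.log 2 := by gcongr
  have hfin : ∑ p ∈ primesOne z, 1 / (p : ℝ) = (Real.log z)⁻¹ * partialSum logDivPrime z +
      ∫ t in (2 : ℝ)..z, t⁻¹ / Real.log t ^ 2 * partialSum logDivPrime t := by
    rw [hlhs, habel, ← hrhs, partialSum]; ring
  rw [hm] at hbound
  rw [hfin]
  have h4 := abs_le.1 hbound
  have h5 := abs_le.1 hfirst
  have h6 := neg_abs_le (Real.log (Real.log 2))
  have h7 := le_abs_self (Real.log (Real.log 2))
  rw [← div_eq_mul_inv] at h4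
  rw [abs_le]
  constructor <;> linarith [h4.1, h4.2, h5.1, h5.2]

/-! ### Logarithmic sums -/

/-- The function `n ↦ a n / n`. -/
noncomputable def divId (a : ArithmeticFunction ℝ) : ArithmeticFunction ℝ :=
  ⟨fun n => a n / n, by simp⟩

theorem divId_apply (a : ArithmeticFunction ℝ) (n : ℕ) : divId a n = a n / n := rfl

theorem divId_nonneg {a : ArithmeticFunction ℝ} (ha : ∀ n, 0 ≤ a n) (n : ℕ) : 0 ≤ divId a n :=
  div_nonneg (ha n) n.cast_nonneg

theorem divId_mul (a b : ArithmeticFunction ℝ) : divId (a * b) = divId a * divId b := by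
  ext n
  simp only [divId_apply, mul_apply, Finset.sum_div]
  refine Finset.sum_congr rfl fun d hd => ?_
  rw [← (Nat.mem_divisorsAntidiagonal.1 hd).1, Nat.cast_mul, mul_div_mul_comm]

theorem sum_invFloor_bounds {x : ℝ} (hx : 1 ≤ x) :
    Real.log x ≤ ∑ m ∈ Finset.Ioc 0 ⌊x⌋₊, (1 / (m : ℝ)) ∧
      ∑ m ∈ Finset.Ioc 0 ⌊x⌋₊, (1 / (m : ℝ)) ≤ 1 + Real.log x := by
  have h1 := log_le_harmonic_floor x (by linarith)
  have h2 := harmonic_floor_le_one_add_log x hx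
  have h3 : ((harmonic ⌊x⌋₊ : ℚ) : ℝ) = ∑ m ∈ Finset.Ioc 0 ⌊x⌋₊, (1 / (m : ℝ)) := by
    rw [harmonic_eq_sum_Icc]
    push_cast
    simp only [one_div]
    rfl
  rw [h3] at h1 h2
  exact ⟨h1, h2⟩

/-- For `n ≤ x`, `x/n` and `⌊x/n⌋` agree up to a factor `2`, so this compares `x ∑ rep n / n` with a
harmonic sum of values of `partialSum rep`. -/
theorem sum_rep_mul_floor (x : ℝ) :
    ∑ n ∈ Finset.Ioc 0 ⌊x⌋₊, rep n * (⌊x / n⌋₊ : ℝ) =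
      ∑ m ∈ Finset.Ioc 0 ⌊x⌋₊, partialSum rep (x / m) := by
  have h1 : partialSum ⇑(rep * (zeta : ArithmeticFunction ℝ)) x =
      ∑ n ∈ Finset.Ioc 0 ⌊x⌋₊, rep n * (⌊x / n⌋₊ : ℝ) := by
    rw [partialSum, sum_Ioc_mul_zeta_eq_sum]
    exact Finset.sum_congr rfl fun n _ => by rw [Nat.floor_div_natCast]
  rw [← h1, mul_comm rep, partialSum_mul]
  refine Finset.sum_congr rfl fun m hm => ?_
  have : m ≠ 0 := by have := Finset.mem_Ioc.1 hm; omega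
  simp [this]

theorem exists_partialSum_divId_rep_le :
    ∃ C : ℝ, 0 < C ∧ ∀ x : ℝ, 1 ≤ x → partialSum (divId rep) x ≤ C * (1 + Real.log x) := by
  obtain ⟨C, hC, h⟩ := exists_partialSum_rep_le
  refine ⟨2 * C, by positivity, fun x hx => ?_⟩
  have hx0 : 0 < x := by linarith
  have h1 : x * partialSum (divId rep) x ≤ 2 * ∑ n ∈ Finset.Ioc 0 ⌊x⌋₊, rep n * (⌊x / n⌋₊ : ℝ) := by
    rw [partialSum, Finset.mul_sum, Finset.mul_sum]
    refine Finset.sum_le_sum fun n hn => ?_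
    obtain ⟨hn1, hnx⟩ := mem_Ioc_floor hn
    have hxn : 1 ≤ x / n := (one_le_div (by linarith)).2 hnx
    have h3 := Nat.lt_floor_add_one (x / n)
    have h4 : (1 : ℝ) ≤ ⌊x / n⌋₊ := by exact_mod_cast (Nat.one_le_floor_iff _).2 hxn
    have h5 : x * divId rep n = rep n * (x / n) := by rw [divId_apply]; ring
    rw [h5]
    have := mul_le_mul_of_nonneg_left (by linarith : x / n ≤ 2 * ⌊x / n⌋₊) (rep_nonneg n)
    linarith
  have h2 : ∑ m ∈ Finset.Ioc 0 ⌊x⌋₊, partialSum rep (x / m) ≤ C * x * (1 + Real.log x) := by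
    refine le_trans ?_ (mul_le_mul_of_nonneg_left (sum_invFloor_bounds hx).2 (by positivity))
    rw [Finset.mul_sum]
    refine Finset.sum_le_sum fun m hm => ?_
    obtain ⟨hm1, hmx⟩ := mem_Ioc_floor hm
    refine (h _ ((one_le_div (by linarith)).2 hmx)).trans_eq (by ring)
  rw [sum_rep_mul_floor] at h1
  refine le_of_mul_le_mul_left ?_ hx0
  linarith

theorem exists_le_partialSum_divId_rep :
    ∃ C : ℝ, 0 < C ∧ ∀ x : ℝ, 1 ≤ x →
      repMean * Real.log x - C ≤ partialSum (divId rep) x := by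
  obtain ⟨C, hC, h⟩ := exists_abs_partialSum_rep_sub_le_rpow
  obtain ⟨C', hC', h'⟩ := exists_sum_mul_rpow_le_self
    (a := (zeta : ArithmeticFunction ℝ)) (fun n => by
      rw [natCoe_apply]; exact Nat.cast_nonneg _) one_pos fun t ht => by
      rw [one_mul]
      refine partialSum_le_self (fun n => ?_) (by linarith)
      rw [natCoe_apply, zeta_apply]
      split_ifs <;> simp
  refine ⟨C * C', by positivity, fun x hx => ?_⟩
  have hx0 : 0 < x := by linarith
  have h1 : ∑ n ∈ Finset.Ioc 0 ⌊x⌋₊, rep n * (⌊x / n⌋₊ : ℝ) ≤ x * partialSum (divId rep) x := by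
    rw [partialSum, Finset.mul_sum]
    refine Finset.sum_le_sum fun n hn => ?_
    have h5 : x * divId rep n = rep n * (x / n) := by rw [divId_apply]; ring
    rw [h5]
    exact mul_le_mul_of_nonneg_left (Nat.floor_le (by positivity)) (rep_nonneg n)
  rw [sum_rep_mul_floor] at h1
  have h2 : repMean * x * ∑ m ∈ Finset.Ioc 0 ⌊x⌋₊, (1 / (m : ℝ)) -
      C * ∑ m ∈ Finset.Ioc 0 ⌊x⌋₊, (zeta : ArithmeticFunction ℝ) m * (x / m) ^ (3 / 4 : ℝ) ≤
      ∑ m ∈ Finset.Ioc 0 ⌊x⌋₊, partialSum rep (x / m) := by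
    rw [Finset.mul_sum, Finset.mul_sum, ← Finset.sum_sub_distrib]
    refine Finset.sum_le_sum fun m hm => ?_
    obtain ⟨hm1, hmx⟩ := mem_Ioc_floor hm
    have hm0 : m ≠ 0 := by have := Finset.mem_Ioc.1 hm; omega
    have h3 := (abs_le.1 (h _ ((one_le_div (by linarith)).2 hmx))).1
    rw [natCoe_apply, zeta_apply_ne hm0, Nat.cast_one, one_mul, mul_assoc, mul_one_div]
    linarith
  have h3 := mul_le_mul_of_nonneg_left (h' x hx) hC.le
  have h4 := mul_le_mul_of_nonneg_left (sum_invFloor_bounds hx).1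
    (mul_pos repMean_pos hx0).le
  refine le_of_mul_le_mul_left ?_ hx0
  linarith

theorem partialSum_divId_mul_le {a b : ArithmeticFunction ℝ} (ha : ∀ n, 0 ≤ a n)
    (hb : ∀ n, 0 ≤ b n) {x : ℝ} (hx : 1 ≤ x) :
    partialSum (divId (a * b)) x ≤ partialSum (divId a) x * partialSum (divId b) x := by
  rw [divId_mul, partialSum_mul, partialSum, Finset.sum_mul]
  refine Finset.sum_le_sum fun d hd => mul_le_mul_of_nonneg_left ?_ (divId_nonneg ha d)
  exact partialSum_mono (divId_nonneg hb) (div_le_self (by linarith) (mem_Ioc_floor hd).1)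

/-- Pairs with both entries at most `x` have product at most `x ^ 2`. Squaring the argument is
harmless, since the sums to be bounded grow like `log x`. -/
theorem le_partialSum_divId_mul {a b : ArithmeticFunction ℝ} (ha : ∀ n, 0 ≤ a n)
    (hb : ∀ n, 0 ≤ b n) {x : ℝ} (hx : 1 ≤ x) :
    partialSum (divId a) x * partialSum (divId b) x ≤ partialSum (divId (a * b)) (x ^ 2) := by
  have hx0 : 0 < x := by linarith
  rw [divId_mul, partialSum_mul, partialSum, Finset.sum_mul]
  refine (Finset.sum_le_sum fun d hd => ?_).trans (Finset.sum_le_sum_of_subset_of_nonneg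
    (Finset.Ioc_subset_Ioc_right (Nat.floor_mono (by nlinarith))) fun d _ _ =>
      mul_nonneg (divId_nonneg ha d) (partialSum_nonneg (divId_nonneg hb) _))
  refine mul_le_mul_of_nonneg_left (partialSum_mono (divId_nonneg hb) ?_) (divId_nonneg ha d)
  obtain ⟨hd1, hdx⟩ := mem_Ioc_floor hd
  rw [le_div_iff₀ (by linarith)]
  nlinarith

theorem partialSum_divId_indOne_le (x : ℝ) :
    partialSum (divId indOne) x ≤ partialSum (divId indS) x :=
  Finset.sum_le_sum fun n _ => div_le_div_of_nonneg_right (indOne_le_indS n) n.cast_nonneg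

theorem exists_partialSum_divId_indRest_le :
    ∃ C : ℝ, 0 < C ∧ ∀ x : ℝ, partialSum (divId indRest) x ≤ C := by
  have hs := summable_indRest
  have hnn : ∀ n : ℕ, 0 ≤ indRest n * (n : ℝ) ^ (-(3 / 4) : ℝ) := fun n =>
    mul_nonneg (indRest_nonneg n) (by positivity)
  refine ⟨∑' n : ℕ, indRest n * (n : ℝ) ^ (-(3 / 4) : ℝ) + 1,
    add_pos_of_nonneg_of_pos (tsum_nonneg hnn) one_pos, fun x => ?_⟩
  refine le_trans ?_ ((hs.sum_le_tsum (Finset.Ioc 0 ⌊x⌋₊) fun n _ => hnn n).trans (by linarith))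
  refine Finset.sum_le_sum fun n hn => ?_
  rw [divId_apply, div_eq_mul_inv, ← Real.rpow_neg_one]
  exact mul_le_mul_of_nonneg_left
    (Real.rpow_le_rpow_of_exponent_le (mem_Ioc_floor hn).1 (by norm_num)) (indRest_nonneg n)

/-- With `M`, `M1` the logarithmic sums of `indS`, `indOne`: `M * M1 ≪ log (x ^ 2) + 1` through
`rep`, and `M ≪ M1` because that of `indRest` is bounded. Hence `M ^ 2 ≪ 1 + log x`. -/
theorem exists_partialSum_divId_indS_le :
    ∃ C : ℝ, 0 < C ∧ ∀ x : ℝ, 1 ≤ x → partialSum (divId indS) x ≤ C * sqrtLog x := by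
  obtain ⟨C₁, hC₁, h₁⟩ := exists_partialSum_divId_rep_le
  obtain ⟨C₂, hC₂, h₂⟩ := exists_partialSum_divId_indRest_le
  refine ⟨√(2 * C₁ * C₂), by positivity, fun x hx => ?_⟩
  have hlog := Real.log_nonneg hx
  set M := partialSum (divId indS) x with hM
  set M1 := partialSum (divId indOne) x with hM1
  have hM0 : 0 ≤ M := partialSum_nonneg (divId_nonneg indS_nonneg) x
  have hM10 : 0 ≤ M1 := partialSum_nonneg (divId_nonneg indOne_nonneg) x
  have h3 : M * M1 ≤ C₁ * (1 + Real.log (x ^ 2)) := by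
    refine (le_partialSum_divId_mul indS_nonneg indOne_nonneg hx).trans ?_
    rw [indS_mul_indOne]
    exact h₁ _ (by nlinarith)
  rw [Real.log_pow] at h3
  push_cast at h3
  have h4 : M ≤ C₂ * M1 := by
    have := partialSum_divId_mul_le indRest_nonneg indOne_nonneg hx
    rw [indRest_mul_indOne] at this
    exact this.trans (mul_le_mul_of_nonneg_right (h₂ x) hM10)
  have h5 : M * M ≤ C₂ * (C₁ * (1 + 2 * Real.log x)) := by
    have h6 := mul_le_mul_of_nonneg_left h4 hM0
    have h7 := mul_le_mul_of_nonneg_left h3 hC₂.le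
    linarith
  rw [sqrtLog, ← Real.sqrt_mul (by positivity)]
  refine Real.le_sqrt_of_sq_le ?_
  have h8 : 0 ≤ C₁ * C₂ := by positivity
  nlinarith

theorem exists_le_sq_partialSum_divId_indS :
    ∃ C : ℝ, 0 < C ∧ ∀ x : ℝ, 1 ≤ x →
      repMean * Real.log x - C ≤ partialSum (divId indS) x ^ 2 := by
  obtain ⟨C, hC, h⟩ := exists_le_partialSum_divId_rep
  refine ⟨C, hC, fun x hx => (h x hx).trans ?_⟩
  rw [← indS_mul_indOne, sq]
  refine (partialSum_divId_mul_le indS_nonneg indOne_nonneg hx).trans ?_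
  exact mul_le_mul_of_nonneg_left (partialSum_divId_indOne_le x)
    (partialSum_nonneg (divId_nonneg indS_nonneg) x)

/-! ### The order of magnitude of the counting function -/

theorem partialSum_mulLog {a : ArithmeticFunction ℝ} {x : ℝ} (hx : 1 ≤ x) :
    partialSum (mulLog a) x =
      partialSum a x * Real.log x - ∑ n ∈ Finset.Ioc 0 ⌊x⌋₊, a n * Real.log (x / n) := by
  rw [partialSum, partialSum, Finset.sum_mul, ← Finset.sum_sub_distrib]
  refine Finset.sum_congr rfl fun n hn => ?_
  rw [mulLog_apply, Real.log_div (by linarith) (one_pos.trans_le (mem_Ioc_floor hn).1).ne']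
  ring

theorem sum_mul_log_div_nonneg {a : ArithmeticFunction ℝ} (ha : ∀ n, 0 ≤ a n) (x : ℝ) :
    0 ≤ ∑ n ∈ Finset.Ioc 0 ⌊x⌋₊, a n * Real.log (x / n) := by
  refine Finset.sum_nonneg fun n hn => mul_nonneg (ha n) (Real.log_nonneg ?_)
  obtain ⟨hn1, hnx⟩ := mem_Ioc_floor hn
  exact (one_le_div (by linarith)).2 hnx

theorem sum_mul_log_div_le {a : ArithmeticFunction ℝ} (ha : ∀ n, 0 ≤ a n) {x : ℝ} (hx : 0 ≤ x) :
    ∑ n ∈ Finset.Ioc 0 ⌊x⌋₊, a n * Real.log (x / n) ≤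
      2 * ∑ n ∈ Finset.Ioc 0 ⌊x⌋₊, a n * (x / n) ^ (3 / 4 : ℝ) := by
  rw [Finset.mul_sum]
  refine Finset.sum_le_sum fun n hn => ?_
  have hxn : 0 ≤ x / n := by positivity
  have h1 := Real.log_le_rpow_div hxn (by norm_num : (0 : ℝ) < 3 / 4)
  have h2 : 0 ≤ (x / n) ^ (3 / 4 : ℝ) := by positivity
  have := mul_le_mul_of_nonneg_left (by linarith : Real.log (x / n) ≤ 2 * (x / n) ^ (3 / 4 : ℝ))
    (ha n)
  linarith

theorem partialSum_mulLog_indS (x : ℝ) :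
    partialSum (mulLog indS) x =
      ∑ m ∈ Finset.Ioc 0 ⌊x⌋₊, indS m * partialSum mangoldtOne (x / m) +
      ∑ b ∈ Finset.Ioc 0 ⌊x⌋₊, mulLog indRest b * partialSum indOne (x / b) := by
  rw [← partialSum_mul, ← partialSum_mul, mulLog_indS]
  simp only [partialSum, ArithmeticFunction.add_apply, Finset.sum_add_distrib]

/-- In `mulLog_indS`, Chebyshev's bound gives `S(x) log x ≪ x ∑ indS m / m + x ≪ x √(1 + log x)`;
then divide by the logarithm. -/
theorem exists_partialSum_indS_le :
    ∃ C : ℝ, 0 < C ∧ ∀ x : ℝ, 1 ≤ x → partialSum indS x ≤ C * (x / sqrtLog x) := by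
  obtain ⟨C₁, hC₁, h₁⟩ := exists_sum_mul_rpow_le_self indS_nonneg one_pos fun t ht => by
    rw [one_mul]
    exact partialSum_le_self indS_le_one (by linarith)
  obtain ⟨C₂, hC₂, h₂⟩ := exists_sum_mul_le_self (mulLog_nonneg indRest_nonneg)
    summable_mulLog_indRest (D := partialSum indOne) one_pos fun t ht => by
    rw [one_mul]
    exact partialSum_le_self indOne_le_one (by linarith)
  obtain ⟨C₃, hC₃, h₃⟩ := exists_partialSum_divId_indS_le
  refine ⟨1 + (Real.log 4 + 4) * C₃ + C₂ + 2 * C₁, by positivity, fun x hx => ?_⟩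
  have hx0 : 0 < x := by linarith
  have hs1 := one_le_sqrtLog hx
  have hs0 := sqrtLog_pos hx
  have h4 := partialSum_mulLog (a := indS) hx
  have h5 := (sum_mul_log_div_le indS_nonneg hx0.le).trans
    (mul_le_mul_of_nonneg_left (h₁ x hx) zero_le_two)
  have h6 := partialSum_mulLog_indS x
  have h7 := h₂ x hx
  have h8 : ∑ m ∈ Finset.Ioc 0 ⌊x⌋₊, indS m * partialSum mangoldtOne (x / m) ≤
      (Real.log 4 + 4) * x * partialSum (divId indS) x := by
    rw [partialSum, Finset.mul_sum]
    refine Finset.sum_le_sum fun m _ => ?_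
    refine (mul_le_mul_of_nonneg_left (partialSum_mangoldtOne_le (by positivity))
      (indS_nonneg m)).trans_eq ?_
    rw [divId_apply]
    ring
  have h9 : (Real.log 4 + 4) * x * partialSum (divId indS) x ≤
      (Real.log 4 + 4) * x * (C₃ * sqrtLog x) :=
    mul_le_mul_of_nonneg_left (h₃ x hx) (by positivity)
  have h10 : partialSum indS x ≤ x := partialSum_le_self indS_le_one hx0.le
  have h11 : partialSum indS x * sqrtLog x ^ 2 ≤
      (1 + (Real.log 4 + 4) * C₃ + C₂ + 2 * C₁) * (x * sqrtLog x) := by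
    rw [sqrtLog_sq hx]
    have h12 : (1 + C₂ + 2 * C₁) * (x * 1) ≤ (1 + C₂ + 2 * C₁) * (x * sqrtLog x) := by gcongr
    linarith
  rw [← mul_div_assoc, le_div_iff₀ hs0]
  refine le_of_mul_le_mul_right ?_ hs0
  linarith

theorem exists_le_partialSum_mangoldtOne :
    ∃ K : ℝ, 1 ≤ K ∧ ∀ y : ℝ, K ≤ y → y / K ≤ partialSum mangoldtOne y := by
  obtain ⟨C, hC, h⟩ := exists_abs_sum_mangoldtOne_div_sub_le
  -- Mertens on `(y/K, y]` gives at least `(log K)/2 - 2 C`, which is `1` for this `K`.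
  have hK : 1 ≤ Real.exp (4 * C + 2) := Real.one_le_exp (by linarith)
  refine ⟨Real.exp (4 * C + 2), hK, fun y hy => ?_⟩
  set K := Real.exp (4 * C + 2) with hKdef
  have hK0 : 0 < K := Real.exp_pos _
  have hy0 : 0 < y := by linarith
  have hyK : 1 ≤ y / K := (one_le_div hK0).2 hy
  have h1 := (abs_le.1 (h y (hK.trans hy))).1
  have h2 := (abs_le.1 (h (y / K) hyK)).2
  rw [Real.log_div hy0.ne' hK0.ne', hKdef, Real.log_exp, ← hKdef] at h2
  have hfl : ⌊y / K⌋₊ ≤ ⌊y⌋₊ := Nat.floor_mono (div_le_self hy0.le hK)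
  rw [← Finset.sum_Ioc_consecutive _ (Nat.zero_le _) hfl] at h1
  have h3 : ∑ d ∈ Finset.Ioc ⌊y / K⌋₊ ⌊y⌋₊, mangoldtOne d / d ≤
      K / y * partialSum mangoldtOne y := by
    rw [partialSum, ← Finset.sum_Ioc_consecutive _ (Nat.zero_le _) hfl, mul_add, Finset.mul_sum,
      Finset.mul_sum]
    refine le_add_of_nonneg_of_le (Finset.sum_nonneg fun d _ =>
      mul_nonneg (by positivity) (mangoldtOne_nonneg d)) (Finset.sum_le_sum fun d hd => ?_)
    have h4 : y / K < d := (Nat.floor_lt (by positivity)).1 (Finset.mem_Ioc.1 hd).1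
    rw [div_eq_inv_mul]
    refine mul_le_mul_of_nonneg_right ?_ (mangoldtOne_nonneg d)
    rw [← inv_div]
    exact inv_anti₀ (by positivity) h4.le
  have h5 : 1 ≤ K / y * partialSum mangoldtOne y := by linarith
  rw [div_mul_eq_mul_div, one_le_div hy0] at h5
  rw [div_le_iff₀ hK0]
  linarith

/-- Same identity as for the upper bound, keeping only `m ≤ x/K`, where `x/m ≥ K` and `partialSum
mangoldtOne (x/m)` is at least `x/(m K)`. -/
theorem exists_le_partialSum_indS :
    ∃ c x₀ : ℝ, 0 < c ∧ 1 ≤ x₀ ∧ ∀ x : ℝ, x₀ ≤ x → c * (x / sqrtLog x) ≤ partialSum indS x := by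
  obtain ⟨K, hK, hψ⟩ := exists_le_partialSum_mangoldtOne
  obtain ⟨C, hC, hM⟩ := exists_le_sq_partialSum_divId_indS
  have hA := repMean_pos
  have hK0 : 0 < K := by linarith
  have hlK := Real.log_nonneg hK
  -- Once `log x ≥ T`, the losses `repMean * log K` and `C` take less than half of `repMean * log
  -- x`.
  set T := 2 * Real.log K + 2 * C / repMean + 1 with hT
  have hT0 : 0 ≤ T := by positivity
  refine ⟨√(repMean / 4) / K, K * Real.exp T, by positivity,
    one_le_mul_of_one_le_of_one_le hK (Real.one_le_exp hT0), fun x hx => ?_⟩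
  have hKx : K ≤ x := (le_mul_of_one_le_right hK0.le (Real.one_le_exp hT0)).trans hx
  have hTx : T ≤ Real.log x := by
    rw [Real.le_log_iff_exp_le (by linarith)]
    exact (le_mul_of_one_le_left (Real.exp_pos T).le hK).trans hx
  have hx1 : 1 ≤ x := hK.trans hKx
  have hx0 : 0 < x := by linarith
  have hxK : 1 ≤ x / K := (one_le_div hK0).2 hKx
  have hs0 := sqrtLog_pos hx1
  have h1 : √(repMean / 4) * sqrtLog x ≤ partialSum (divId indS) (x / K) := by
    rw [sqrtLog, ← Real.sqrt_mul (by positivity)]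
    refine (Real.sqrt_le_left (partialSum_nonneg (divId_nonneg indS_nonneg) _)).2 ?_
    refine le_trans ?_ (hM _ hxK)
    rw [Real.log_div hx0.ne' hK0.ne']
    have h2 : repMean * T ≤ repMean * Real.log x := mul_le_mul_of_nonneg_left hTx hA.le
    have h3 : repMean * T = 2 * repMean * Real.log K + 2 * C + repMean := by
      rw [hT]; field_simp
    have h4 : 0 ≤ repMean * Real.log K := by positivity
    linarith
  have h2 := partialSum_mulLog (a := indS) hx1
  have h3 := sum_mul_log_div_nonneg indS_nonneg x
  have h4 := partialSum_mulLog_indS x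
  have h5 : 0 ≤ ∑ b ∈ Finset.Ioc 0 ⌊x⌋₊, mulLog indRest b * partialSum indOne (x / b) :=
    Finset.sum_nonneg fun b _ => mul_nonneg (mulLog_nonneg indRest_nonneg b)
      (partialSum_nonneg indOne_nonneg _)
  have h6 : x / K * partialSum (divId indS) (x / K) ≤
      ∑ m ∈ Finset.Ioc 0 ⌊x⌋₊, indS m * partialSum mangoldtOne (x / m) := by
    rw [partialSum, Finset.mul_sum]
    refine (Finset.sum_le_sum fun m hm => ?_).trans (Finset.sum_le_sum_of_subset_of_nonneg
      (Finset.Ioc_subset_Ioc_right (Nat.floor_mono (div_le_self hx0.le hK))) fun m _ _ =>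
        mul_nonneg (indS_nonneg m) (partialSum_nonneg mangoldtOne_nonneg _))
    obtain ⟨hm1, hmx⟩ := mem_Ioc_floor hm
    have hm0 : 0 < (m : ℝ) := by linarith
    have h7 : K ≤ x / m := by
      rw [le_div_iff₀ hm0, mul_comm]
      exact (le_div_iff₀ hK0).1 hmx
    have h8 : x / K * divId indS m = indS m * (x / m / K) := by
      rw [divId_apply]; ring
    rw [h8]
    exact mul_le_mul_of_nonneg_left (hψ _ h7) (indS_nonneg m)
  have h7 : x / K * (√(repMean / 4) * sqrtLog x) ≤ partialSum indS x * Real.log x := by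
    have := mul_le_mul_of_nonneg_left h1 (by positivity : 0 ≤ x / K)
    linarith
  have h8 : partialSum indS x * Real.log x ≤ partialSum indS x * sqrtLog x ^ 2 := by
    rw [sqrtLog_sq hx1]
    exact mul_le_mul_of_nonneg_left (by linarith) (partialSum_nonneg indS_nonneg x)
  rw [← mul_div_assoc, div_le_iff₀ hs0]
  refine le_of_mul_le_mul_right ?_ hs0
  calc √(repMean / 4) / K * x * sqrtLog x = x / K * (√(repMean / 4) * sqrtLog x) := by ring
    _ ≤ partialSum indS x * sqrtLog x ^ 2 := h7.trans h8
    _ = _ := by ring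

/-! ### Slow variation of the density of sums of two squares -/

theorem abs_moebiusOne_le (n : ℕ) : |moebiusOne n| ≤ indOne n := by
  rw [moebiusOne, pmul_apply, abs_mul, abs_of_nonneg (indOne_nonneg n)]
  refine mul_le_of_le_one_right (indOne_nonneg n) ?_
  rw [intCoe_apply]
  exact_mod_cast abs_moebius_le_one

theorem exists_sum_indOne_mul_rpow_le :
    ∃ C : ℝ, 0 < C ∧ ∀ x : ℝ, 1 ≤ x →
      ∑ d ∈ Finset.Ioc 0 ⌊x⌋₊, indOne d * (x / d) ^ (3 / 4 : ℝ) ≤ C * (x / sqrtLog x) := by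
  obtain ⟨C, hC, h⟩ := exists_partialSum_indS_le
  exact exists_sum_mul_rpow_le_div_sqrtLog indOne_nonneg hC fun t ht =>
    (Finset.sum_le_sum fun n _ => indOne_le_indS n).trans (h t ht)

theorem abs_sum_moebiusOne_mul_le {F : ℝ → ℝ} {C : ℝ}
    (hF : ∀ y, 1 ≤ y → |F y| ≤ C * y ^ (3 / 4 : ℝ)) (x : ℝ) :
    |∑ d ∈ Finset.Ioc 0 ⌊x⌋₊, moebiusOne d * F (x / d)| ≤
      C * ∑ d ∈ Finset.Ioc 0 ⌊x⌋₊, indOne d * (x / d) ^ (3 / 4 : ℝ) := by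
  refine (Finset.abs_sum_le_sum_abs _ _).trans ?_
  rw [Finset.mul_sum]
  refine Finset.sum_le_sum fun d hd => ?_
  obtain ⟨hd1, hdx⟩ := mem_Ioc_floor hd
  have h1 := hF _ ((one_le_div (by linarith)).2 hdx)
  rw [abs_mul]
  calc |moebiusOne d| * |F (x / d)| ≤ indOne d * (C * (x / d) ^ (3 / 4 : ℝ)) :=
        mul_le_mul (abs_moebiusOne_le d) h1 (abs_nonneg _) (indOne_nonneg d)
    _ = _ := by ring

/-- Summing `indS = moebiusOne * rep` gives `S(x) = repMean * x ∑ moebiusOne d / d` up to an error;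
`S(x)` and the error are both `O(x/sqrtLog x)`, so the remaining term is too. -/
theorem exists_abs_partialSum_divId_moebiusOne_le :
    ∃ C : ℝ, 0 < C ∧ ∀ x : ℝ, 1 ≤ x → |partialSum (divId moebiusOne) x| ≤ C / sqrtLog x := by
  obtain ⟨C₁, hC₁, h₁⟩ := exists_partialSum_indS_le
  obtain ⟨C₂, hC₂, h₂⟩ := exists_sum_indOne_mul_rpow_le
  obtain ⟨C₃, hC₃, h₃⟩ := exists_abs_partialSum_rep_sub_le_rpow
  have hA := repMean_pos
  refine ⟨(C₁ + C₃ * C₂) / repMean, by positivity, fun x hx => ?_⟩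
  have hx0 : 0 < x := by linarith
  have hs0 := sqrtLog_pos hx
  have h4 := abs_sum_moebiusOne_mul_le h₃ x
  have h5 : ∑ d ∈ Finset.Ioc 0 ⌊x⌋₊, moebiusOne d * (partialSum rep (x / d) - repMean * (x / d)) =
      partialSum indS x - repMean * x * partialSum (divId moebiusOne) x := by
    rw [indS_eq_moebiusOne_mul_rep, partialSum_mul, partialSum, Finset.mul_sum,
      ← Finset.sum_sub_distrib]
    refine Finset.sum_congr rfl fun d _ => ?_
    rw [divId_apply]
    ring
  rw [h5] at h4
  have h6 := mul_le_mul_of_nonneg_left (h₂ x hx) hC₃.le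
  have h7 := h₁ x hx
  have h8 := partialSum_nonneg indS_nonneg x
  have h9 : |repMean * x * partialSum (divId moebiusOne) x| ≤ (C₁ + C₃ * C₂) * (x / sqrtLog x) := by
    rw [abs_le] at h4 ⊢
    constructor <;> linarith [h4.1, h4.2]
  rw [abs_mul, abs_of_pos (by positivity)] at h9
  rw [div_div, le_div_iff₀ (by positivity)]
  have h10 := mul_le_mul_of_nonneg_right h9 hs0.le
  have h11 : (C₁ + C₃ * C₂) * (x / sqrtLog x) * sqrtLog x = (C₁ + C₃ * C₂) * x := by
    field_simp
  rw [h11] at h10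
  refine le_of_mul_le_mul_right ?_ hx0
  linarith

theorem exists_abs_two_mul_partialSum_indS_mul_log_sub_le :
    ∃ C : ℝ, 0 < C ∧ ∀ x : ℝ, 1 ≤ x →
      |2 * partialSum indS x * Real.log x - repMean * x *
        ∑ d ∈ Finset.Ioc 0 ⌊x⌋₊, divId moebiusOne d * Real.log (x / d)| ≤
      C * (x / sqrtLog x) := by
  obtain ⟨C₁, hC₁, h₁⟩ := exists_partialSum_indS_le
  obtain ⟨C₂, hC₂, h₂⟩ := exists_sum_indOne_mul_rpow_le
  obtain ⟨C₃, hC₃, h₃⟩ := exists_abs_partialSum_mulLog_rep_sub_le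
  obtain ⟨C₄, hC₄, h₄⟩ := exists_abs_partialSum_divId_moebiusOne_le
  obtain ⟨C₅, hC₅, h₅⟩ := exists_sum_mul_rpow_le_div_sqrtLog indS_nonneg hC₁ h₁
  obtain ⟨C₆, hC₆, h₆⟩ := exists_sum_mul_le_div_sqrtLog (mulLog_nonneg indRest_nonneg)
    summable_mulLog_indRest (D := partialSum indOne) hC₁ fun t ht =>
    (Finset.sum_le_sum fun n _ => indOne_le_indS n).trans (h₁ t ht)
  have hA := repMean_pos
  refine ⟨C₃ * C₂ + repMean * C₄ + 4 * C₅ + C₆, by positivity, fun x hx => ?_⟩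
  have hx0 : 0 < x := by linarith
  set ρ := ∑ d ∈ Finset.Ioc 0 ⌊x⌋₊, divId moebiusOne d * Real.log (x / d) with hρ
  have h7 := abs_sum_moebiusOne_mul_le h₃ x
  have h8 : ∑ d ∈ Finset.Ioc 0 ⌊x⌋₊, moebiusOne d * (partialSum (mulLog rep) (x / d) -
      (repMean * (x / d) * Real.log (x / d) - repMean * (x / d))) =
      ∑ d ∈ Finset.Ioc 0 ⌊x⌋₊, moebiusOne d * partialSum (mulLog rep) (x / d) -
      (repMean * x * ρ - repMean * x * partialSum (divId moebiusOne) x) := by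
    rw [hρ, partialSum, Finset.mul_sum, Finset.mul_sum, ← Finset.sum_sub_distrib,
      ← Finset.sum_sub_distrib]
    refine Finset.sum_congr rfl fun d _ => ?_
    rw [divId_apply]
    ring
  rw [h8] at h7
  have h9 : 2 * partialSum (mulLog indS) x =
      ∑ d ∈ Finset.Ioc 0 ⌊x⌋₊, moebiusOne d * partialSum (mulLog rep) (x / d) +
      ∑ b ∈ Finset.Ioc 0 ⌊x⌋₊, mulLog indRest b * partialSum indOne (x / b) := by
    have h10 : 2 * partialSum (mulLog indS) x = partialSum ⇑(2 * mulLog indS) x := by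
      rw [two_mul, two_mul]
      simp only [partialSum, ArithmeticFunction.add_apply, Finset.sum_add_distrib]
    rw [h10, two_mul_mulLog_indS, ← partialSum_mul, ← partialSum_mul]
    simp only [partialSum, ArithmeticFunction.add_apply, Finset.sum_add_distrib]
  have h10 : 0 ≤ ∑ b ∈ Finset.Ioc 0 ⌊x⌋₊, mulLog indRest b * partialSum indOne (x / b) :=
    Finset.sum_nonneg fun b _ => mul_nonneg (mulLog_nonneg indRest_nonneg b)
      (partialSum_nonneg indOne_nonneg _)
  have h11 := h₆ x hx
  have h12 := partialSum_mulLog (a := indS) hx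
  have h13 := sum_mul_log_div_nonneg indS_nonneg x
  have h14 := (sum_mul_log_div_le indS_nonneg hx0.le).trans
    (mul_le_mul_of_nonneg_left (h₅ x hx) zero_le_two)
  have h15 := mul_le_mul_of_nonneg_left (h₂ x hx) hC₃.le
  have h16 : |repMean * x * partialSum (divId moebiusOne) x| ≤
      repMean * C₄ * (x / sqrtLog x) := by
    rw [abs_mul, abs_of_pos (by positivity)]
    refine (mul_le_mul_of_nonneg_left (h₄ x hx) (by positivity)).trans_eq (by ring)
  rw [abs_le] at h7 h16 ⊢
  constructor <;> linarith [h7.1, h7.2, h16.1, h16.2]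

/-- Compare the formula for `2 S(t) log t` at `t = x` and `t = y = x/w`: the values of `ρ` differ by
`O(log w/sqrtLog x)`, and so does `log x` from `log y` after multiplication by `S(y)/y`. -/
theorem exists_abs_partialSum_indS_div_sub_le :
    ∃ C x₀ : ℝ, 0 < C ∧ 1 < x₀ ∧ ∀ x w : ℝ, x₀ ≤ x → 1 ≤ w → w ^ 2 ≤ x →
      |partialSum indS (x / w) - partialSum indS x / w| ≤
        C * ((1 + Real.log w) / w) / Real.log x * partialSum indS x := by
  obtain ⟨C₁, hC₁, h₁⟩ := exists_partialSum_indS_le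
  obtain ⟨C₂, hC₂, h₂⟩ := exists_abs_partialSum_divId_moebiusOne_le
  obtain ⟨C₃, hC₃, h₃⟩ := exists_abs_two_mul_partialSum_indS_mul_log_sub_le
  obtain ⟨c, x₀, hc, hx₀, hlow⟩ := exists_le_partialSum_indS
  have hA := repMean_pos
  set D := repMean * C₂ + 2 * C₃ + 2 * C₁ with hD
  refine ⟨D / c, x₀ + 1, by positivity, by linarith, fun x w hx hw hwx => ?_⟩
  have hx1 : 1 < x := by linarith
  have hx0 : 0 < x := by linarith
  have hw0 : 0 < w := by linarith
  set y := x / w with hy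
  have hxy : x = y * w := by rw [hy]; field_simp
  have hy1 : 1 ≤ y := by
    rw [hy, one_le_div hw0]; nlinarith
  have hy0 : 0 < y := by linarith
  have hyx : y ≤ x := div_le_self hx0.le hw
  have hwy : w ≤ y := by
    rw [hy, le_div_iff₀ hw0]; nlinarith
  have hlw := Real.log_nonneg hw
  have hlx : 0 < Real.log x := Real.log_pos hx1
  have hlxy : Real.log x = Real.log y + Real.log w := by
    rw [hxy, Real.log_mul hy0.ne' hw0.ne']
  have hlwy : Real.log w ≤ Real.log y := Real.log_le_log hw0 hwy
  have hsx := sqrtLog_pos hx1.le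
  have hsy := sqrtLog_pos hy1
  -- Here `w ^ 2 ≤ x` enters: it gives `log x ≤ 2 log y`.
  have hs : sqrtLog x ≤ 2 * sqrtLog y := by
    have h4 := sqrtLog_sq hx1.le
    have h5 := sqrtLog_sq hy1
    refine abs_le_of_sq_le_sq' ?_ (by positivity) |>.2
    rw [mul_pow, h4, h5]
    linarith
  set s := 1 / sqrtLog x with hsdef
  have hs0 : 0 < s := by positivity
  have hsy' : 1 / sqrtLog y ≤ 2 * s := by
    rw [hsdef, mul_one_div, div_le_div_iff₀ hsy hsx]
    linarith
  set R := partialSum indS x / x with hR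
  set Q := partialSum indS y / y with hQ
  set ρ := fun t : ℝ => ∑ d ∈ Finset.Ioc 0 ⌊t⌋₊, divId moebiusOne d * Real.log (t / d) with hρ
  have hnorm : ∀ t : ℝ, 1 ≤ t →
      |2 * (partialSum indS t / t) * Real.log t - repMean * ρ t| ≤ C₃ * (1 / sqrtLog t) := by
    intro t ht
    have ht0 : 0 < t := by linarith
    have h4 := h₃ t ht
    have h5 : 2 * partialSum indS t * Real.log t - repMean * t * ρ t =
        t * (2 * (partialSum indS t / t) * Real.log t - repMean * ρ t) := by
      field_simp
    rw [h5, abs_mul, abs_of_pos ht0] at h4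
    refine le_of_mul_le_mul_left ?_ ht0
    refine h4.trans_eq (by ring)
  have h4 := hnorm x hx1.le
  have h5 : |2 * Q * Real.log y - repMean * ρ y| ≤ C₃ * (2 * s) :=
    (hnorm y hy1).trans (mul_le_mul_of_nonneg_left hsy' hC₃.le)
  have h6 : |ρ x - ρ y| ≤ C₂ * (2 * s) * Real.log w := by
    have h7 := abs_sum_mul_log_div_sub_le (c := divId moebiusOne) (by simp) hy1 hyx
      (B := C₂ * (2 * s)) fun t hyt _ => (h₂ t (hy1.trans hyt)).trans (by
        refine le_trans ?_ (mul_le_mul_of_nonneg_left hsy' hC₂.le)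
        rw [mul_one_div]
        exact div_le_div_of_nonneg_left hC₂.le hsy (sqrtLog_mono hy1 hyt))
    have h8 : x / y = w := by rw [hxy]; field_simp
    rwa [h8] at h7
  have h7 : |repMean * (ρ x - ρ y)| ≤ repMean * (C₂ * (2 * s) * Real.log w) := by
    rw [abs_mul, abs_of_pos hA]
    exact mul_le_mul_of_nonneg_left h6 hA.le
  have hQ0 : 0 ≤ Q := div_nonneg (partialSum_nonneg indS_nonneg y) hy0.le
  have hQs : Q ≤ C₁ * (2 * s) := by
    refine le_trans ?_ (mul_le_mul_of_nonneg_left hsy' hC₁.le)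
    rw [hQ, div_le_iff₀ hy0]
    exact (h₁ y hy1).trans_eq (by ring)
  have h8 : Q * Real.log w ≤ C₁ * (2 * s) * Real.log w := mul_le_mul_of_nonneg_right hQs hlw
  have h8' : 0 ≤ Q * Real.log w := mul_nonneg hQ0 hlw
  have h9 : |(Q - R) * Real.log x| ≤ D * s * (1 + Real.log w) := by
    have h10 : (Q - R) * Real.log x = 1 / 2 * (2 * Q * Real.log y - repMean * ρ y) -
        1 / 2 * (2 * R * Real.log x - repMean * ρ x) - 1 / 2 * (repMean * (ρ x - ρ y)) +
        Q * Real.log w := by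
      rw [hlxy]; ring
    have h11 : 0 ≤ C₁ * s := by positivity
    have h12 : 0 ≤ C₃ * s * Real.log w := by positivity
    have h13 : 0 ≤ repMean * C₂ * s := by positivity
    have h14 : 0 ≤ C₃ * s := by positivity
    rw [h10, hD]
    rw [abs_le] at h4 h5 h7 ⊢
    constructor <;> linarith [h4.1, h4.2, h5.1, h5.2, h7.1, h7.2]
  -- The lower bound for `S(x)` turns the absolute error, a multiple of `s`, into one relative to
  -- `R`.
  have h10 : c * s ≤ R := by
    rw [hR, le_div_iff₀ hx0]
    refine le_trans (le_of_eq ?_) (hlow x (by linarith))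
    rw [hsdef]; ring
  have h11 : s ≤ R / c := by rw [le_div_iff₀ hc]; linarith
  rw [abs_mul, abs_of_pos hlx] at h9
  have h12 : |Q - R| ≤ D / c * (1 + Real.log w) / Real.log x * R := by
    have h13 : D * s * (1 + Real.log w) ≤ D * (R / c) * (1 + Real.log w) := by gcongr
    have h14 : |Q - R| ≤ D * (R / c) * (1 + Real.log w) / Real.log x := by
      rw [le_div_iff₀ hlx]; exact h9.trans h13
    refine h14.trans_eq (by ring)
  have h13 : partialSum indS y - partialSum indS x / w = y * (Q - R) := by
    rw [hQ, hR, hy]; field_simp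
  rw [h13, abs_mul, abs_of_pos hy0]
  refine (mul_le_mul_of_nonneg_left h12 hy0.le).trans_eq ?_
  rw [hR, hy]; field_simp

/-! ### Moments of the number of small prime divisors -/

theorem indS_mul_of_indOne {d : ℕ} (hd : indOne d = 1) (m : ℕ) : indS (d * m) = indS m := by
  rcases eq_or_ne m 0 with rfl | hm
  · simp
  obtain ⟨hd0, hd1⟩ : d ≠ 0 ∧ ∀ p ∈ d.primeFactors, p % 4 = 1 := by
    by_contra h
    rw [indOne_apply, if_neg h] at hd
    norm_num at hd
  have h : d * m ∈ sumTwoSq ↔ m ∈ sumTwoSq := by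
    rw [mem_sumTwoSq_iff (d * m), mem_sumTwoSq_iff m]
    refine forall_congr' fun q => imp_congr_right fun hq => ?_
    have : q ∉ d.primeFactors := fun h => by have := hd1 q h; omega
    rw [← Nat.support_factorization, Finsupp.notMem_support_iff] at this
    rw [Nat.factorization_mul hd0 hm, Finsupp.add_apply, this, zero_add]
  have h' : d * m ≠ 0 ∧ d * m ∈ sumTwoSq ↔ m ≠ 0 ∧ m ∈ sumTwoSq := by
    rw [h]; simp [hd0]
  rw [indS_apply, indS_apply]
  by_cases h1 : m ≠ 0 ∧ m ∈ sumTwoSq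
  · rw [if_pos h1, if_pos (h'.2 h1)]
  · rw [if_neg h1, if_neg fun h2 => h1 (h'.1 h2)]

/-- Division by `d` changes no exponent of a prime `3 mod 4`, so the count is exact, even when `d`
and `n / d` share factors. -/
theorem sum_indS_dvd {d : ℕ} (hd : indOne d = 1) (x : ℝ) :
    ∑ n ∈ Finset.Ioc 0 ⌊x⌋₊, indS n * (if d ∣ n then 1 else 0) = partialSum indS (x / d) := by
  have hd0 : 0 < d := by
    rcases Nat.eq_zero_or_pos d with rfl | h
    · simp at hd
    · exact h
  simp only [mul_ite, mul_one, mul_zero]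
  rw [← Finset.sum_filter, partialSum, Nat.floor_div_natCast]
  symm
  refine Finset.sum_nbij' (fun m => d * m) (fun n => n / d) ?_ ?_ ?_ ?_ ?_
  · intro m hm
    rw [Finset.mem_Ioc, Nat.le_div_iff_mul_le hd0] at hm
    rw [Finset.mem_filter, Finset.mem_Ioc]
    exact ⟨⟨Nat.mul_pos hd0 hm.1, by linarith [hm.2, mul_comm m d]⟩, dvd_mul_right _ _⟩
  · intro n hn
    rw [Finset.mem_filter, Finset.mem_Ioc] at hn
    rw [Finset.mem_Ioc]
    exact ⟨Nat.div_pos (Nat.le_of_dvd hn.1.1 hn.2) hd0, Nat.div_le_div_right hn.1.2⟩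
  · intro m _
    exact Nat.mul_div_cancel_left m hd0
  · intro n hn
    exact Nat.mul_div_cancel' (Finset.mem_filter.1 hn).2
  · intro m _
    exact (indS_mul_of_indOne hd m).symm

theorem indOne_of_mem_primesOne {z : ℝ} {p : ℕ} (hp : p ∈ primesOne z) : indOne p = 1 := by
  rw [mem_primesOne] at hp
  have := indOne_prime_pow hp.1 1
  rwa [pow_one, if_pos (Or.inr hp.2.1)] at this

/-- The number of prime divisors `p ≡ 1 mod 4`, `p ≤ z`, of `n`. -/
noncomputable def omegaUpTo (z : ℝ) (n : ℕ) : ℝ := ∑ p ∈ primesOne z, if p ∣ n then 1 else 0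

theorem sum_indS_mul_omegaUpTo (x z : ℝ) :
    ∑ n ∈ Finset.Ioc 0 ⌊x⌋₊, indS n * omegaUpTo z n =
      ∑ p ∈ primesOne z, partialSum indS (x / p) := by
  simp only [omegaUpTo, Finset.mul_sum]
  rw [Finset.sum_comm]
  exact Finset.sum_congr rfl fun p hp => sum_indS_dvd (indOne_of_mem_primesOne hp) x

theorem sum_indS_mul_omegaUpTo_sq (x z : ℝ) :
    ∑ n ∈ Finset.Ioc 0 ⌊x⌋₊, indS n * omegaUpTo z n ^ 2 =
      ∑ p ∈ primesOne z, partialSum indS (x / p) +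
      ∑ p ∈ primesOne z, ∑ q ∈ (primesOne z).erase p, partialSum indS (x / (p * q)) := by
  have h : ∀ n, indS n * omegaUpTo z n ^ 2 = ∑ p ∈ primesOne z, ∑ q ∈ primesOne z,
      indS n * ((if p ∣ n then 1 else 0) * (if q ∣ n then 1 else 0)) := by
    intro n
    rw [omegaUpTo, sq, Finset.sum_mul_sum, Finset.mul_sum]
    simp only [Finset.mul_sum]
  simp only [h]
  rw [Finset.sum_comm, ← Finset.sum_add_distrib]
  refine Finset.sum_congr rfl fun p hp => ?_
  rw [Finset.sum_comm, ← Finset.add_sum_erase _ _ hp]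
  congr 1
  · rw [← sum_indS_dvd (indOne_of_mem_primesOne hp)]
    refine Finset.sum_congr rfl fun n _ => ?_
    split_ifs <;> simp
  · refine Finset.sum_congr rfl fun q hq => ?_
    obtain ⟨hqp, hq⟩ := Finset.mem_erase.1 hq
    have hpq : p.Coprime q :=
      (Nat.coprime_primes (mem_primesOne.1 hp).1 (mem_primesOne.1 hq).1).2 (Ne.symm hqp)
    have h1 : indOne (p * q) = 1 := by
      rw [indOne_mul, indOne_of_mem_primesOne hp, indOne_of_mem_primesOne hq, mul_one]
    have h2 := sum_indS_dvd h1 x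
    rw [Nat.cast_mul] at h2
    rw [← h2]
    refine Finset.sum_congr rfl fun n _ => ?_
    have h3 : p * q ∣ n ↔ p ∣ n ∧ q ∣ n :=
      ⟨fun h => ⟨(dvd_mul_right _ _).trans h, (dvd_mul_left _ _).trans h⟩,
        fun h => hpq.mul_dvd_of_dvd_of_dvd h.1 h.2⟩
    by_cases hp' : p ∣ n <;> by_cases hq' : q ∣ n <;> simp [h3, hp', hq']

/-- The product of the prime divisors exceeding `z` divides `n ≤ z ^ 4`, so there are at most four.
-/
theorem omegaOne_bounds {x z : ℝ} (hz : 1 < z) (hzx : z ^ 4 = x) {n : ℕ}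
    (hn : n ∈ Finset.Ioc 0 ⌊x⌋₊) :
    omegaUpTo z n ≤ omegaOne n ∧ (omegaOne n : ℝ) ≤ omegaUpTo z n + 4 := by
  obtain ⟨hn1, hnx⟩ := mem_Ioc_floor hn
  have hn0 : n ≠ 0 := by rintro rfl; norm_num at hn1
  set U : Finset ℕ := {p ∈ n.primeFactors | p ≡ 1 [MOD 4]} with hU
  have hUcard : omegaOne n = U.card := rfl
  have hmemU : ∀ p, p ∈ U ↔ p.Prime ∧ p ∣ n ∧ p % 4 = 1 := fun p => by
    rw [hU, Finset.mem_filter, Nat.mem_primeFactors, Nat.ModEq]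
    exact ⟨fun h => ⟨h.1.1, h.1.2.1, h.2⟩, fun h => ⟨⟨h.1, h.2.1, hn0⟩, h.2.2⟩⟩
  have hW : omegaUpTo z n = ({p ∈ U | (p : ℝ) ≤ z} : Finset ℕ).card := by
    rw [omegaUpTo, Finset.sum_ite, Finset.sum_const_zero, add_zero, Finset.sum_const,
      nsmul_eq_mul, mul_one]
    congr 2
    ext p
    rw [Finset.mem_filter, Finset.mem_filter, mem_primesOne, hmemU]
    tauto
  set V : Finset ℕ := {p ∈ U | ¬ (p : ℝ) ≤ z} with hV
  have hsplit : ({p ∈ U | (p : ℝ) ≤ z} : Finset ℕ).card + V.card = U.card :=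
    Finset.card_filter_add_card_filter_not _
  have hVle : V.card ≤ 4 := by
    have h1 : ∏ p ∈ V, p ∣ n := (Finset.prod_dvd_prod_of_subset _ _ _
      ((Finset.filter_subset _ _).trans (Finset.filter_subset _ _))).trans
      (Nat.prod_primeFactors_dvd n)
    have h2 : ((∏ p ∈ V, p : ℕ) : ℝ) ≤ n := by
      exact_mod_cast Nat.le_of_dvd (Nat.pos_of_ne_zero hn0) h1
    have h3 : z ^ V.card ≤ ∏ p ∈ V, (p : ℝ) := by
      rw [← Finset.prod_const]
      refine Finset.prod_le_prod (fun _ _ => by linarith) fun p hp => ?_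
      exact (not_le.1 (Finset.mem_filter.1 hp).2).le
    have h4 : z ^ V.card ≤ z ^ 4 := by
      rw [hzx]
      push_cast at h2
      linarith
    exact (pow_le_pow_iff_right₀ hz).1 h4
  rw [hW, hUcard]
  constructor
  · exact_mod_cast Nat.le_of_add_right_le hsplit.le
  · exact_mod_cast (by omega)

/-- The sum of the reciprocals of the primes `p ≡ 1 mod 4`, `p ≤ z`. -/
noncomputable def invSum (z : ℝ) : ℝ := ∑ p ∈ primesOne z, 1 / (p : ℝ)

theorem invSum_nonneg (z : ℝ) : 0 ≤ invSum z := Finset.sum_nonneg fun p _ => by positivity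

/-- The choice `z ^ 4 = x` ensures `(p q) ^ 2 ≤ x`, so slow variation applies to products of two
primes. The errors add up to multiples of `E / log x` and `E H / log x`, with `E = O(log x)` by
Mertens. -/
theorem exists_omegaUpTo_moments :
    ∃ C x₀ : ℝ, 0 < C ∧ ∀ x z : ℝ, x₀ ≤ x → 1 < z → z ^ 4 = x →
      |∑ n ∈ Finset.Ioc 0 ⌊x⌋₊, indS n * omegaUpTo z n - partialSum indS x * invSum z| ≤
        C * partialSum indS x ∧
      |∑ n ∈ Finset.Ioc 0 ⌊x⌋₊, indS n * omegaUpTo z n ^ 2 - partialSum indS x * invSum z ^ 2| ≤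
        C * partialSum indS x * (1 + invSum z) := by
  obtain ⟨C, x₀, hC, hx₀, hvar⟩ := exists_abs_partialSum_indS_div_sub_le
  obtain ⟨C', hC', hlog⟩ := exists_abs_partialSum_logDivPrime_sub_le
  have hl2 : 0 < 1 + 2 * C' := by linarith
  -- The `2` absorbs two terms of the second moment: the main term `S H` of the sum over single
  -- primes, and the missing diagonal `S ∑ 1/p²`.
  refine ⟨4 * C * (1 + 2 * C') + 2, max x₀ (Real.exp 1), by positivity,
    fun x z hx hz hzx => ?_⟩
  have hx1 : x₀ ≤ x := (le_max_left _ _).trans hx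
  have hxe : 1 ≤ Real.log x := by
    rw [Real.le_log_iff_exp_le (by linarith)]
    exact (le_max_right _ _).trans hx
  have hx0 : 0 < x := by linarith
  have hlx : 0 < Real.log x := by linarith
  set S := partialSum indS x with hS
  set H := invSum z with hH
  have hS0 : 0 ≤ S := partialSum_nonneg indS_nonneg x
  have hH0 : 0 ≤ H := invSum_nonneg z
  have hlz : Real.log x = 4 * Real.log z := by
    rw [← hzx, Real.log_pow]; norm_num
  set E := ∑ p ∈ primesOne z, (1 + Real.log p) / (p : ℝ) with hE
  have hlogp : ∀ p ∈ primesOne z, 1 ≤ Real.log p := by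
    intro p hp
    obtain ⟨h1, h2, -⟩ := mem_primesOne.1 hp
    have h3 : 3 ≤ p := by have := h1.two_le; omega
    have h4 : Real.exp 1 ≤ p := by
      have : (3 : ℝ) ≤ p := by exact_mod_cast h3
      linarith [Real.exp_one_lt_three]
    rwa [Real.le_log_iff_exp_le (by linarith [Real.exp_pos 1])]
  have hE0 : 0 ≤ E := Finset.sum_nonneg fun p hp =>
    div_nonneg (by linarith [hlogp p hp]) p.cast_nonneg
  have hEle : E ≤ 2 * (1 + 2 * C') * Real.log x := by
    have h1 : E ≤ 2 * partialSum logDivPrime z := by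
      rw [partialSum_logDivPrime, Finset.mul_sum]
      refine Finset.sum_le_sum fun p hp => ?_
      rw [← mul_div_assoc]
      exact div_le_div_of_nonneg_right (by linarith [hlogp p hp]) p.cast_nonneg
    have h2 := (abs_le.1 (hlog z hz.le)).2
    nlinarith
  have hp1 : ∀ p ∈ primesOne z, 1 ≤ (p : ℝ) ∧ (p : ℝ) ≤ z := fun p hp => by
    obtain ⟨h1, -, h3⟩ := mem_primesOne.1 hp
    exact ⟨by exact_mod_cast h1.one_lt.le, h3⟩
  have hfirst : |∑ p ∈ primesOne z, partialSum indS (x / p) - S * H| ≤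
      2 * C * (1 + 2 * C') * S := by
    have h1 : ∑ p ∈ primesOne z, partialSum indS (x / p) - S * H =
        ∑ p ∈ primesOne z, (partialSum indS (x / p) - S / p) := by
      rw [Finset.sum_sub_distrib, hH, invSum, Finset.mul_sum]
      simp only [mul_one_div]
    rw [h1]
    refine (Finset.abs_sum_le_sum_abs _ _).trans ?_
    have h2 : ∑ p ∈ primesOne z, |partialSum indS (x / p) - S / p| ≤ C * E / Real.log x * S := by
      rw [hE, Finset.mul_sum, Finset.sum_div, Finset.sum_mul]
      refine Finset.sum_le_sum fun p hp => ?_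
      obtain ⟨hp1, hpz⟩ := hp1 p hp
      refine hvar x p hx1 hp1 ?_
      rw [← hzx]
      calc (p : ℝ) ^ 2 ≤ z ^ 2 := by gcongr
        _ ≤ z ^ 4 := pow_le_pow_right₀ hz.le (by norm_num)
    refine h2.trans (mul_le_mul_of_nonneg_right ?_ hS0)
    rw [div_le_iff₀ hlx]
    have := mul_le_mul_of_nonneg_left hEle hC.le
    linarith
  have hsecond : |∑ p ∈ primesOne z, ∑ q ∈ (primesOne z).erase p, partialSum indS (x / (p * q)) -
      ∑ p ∈ primesOne z, ∑ q ∈ (primesOne z).erase p, S / (p * q)| ≤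
      4 * C * (1 + 2 * C') * S * H := by
    simp only [← Finset.sum_sub_distrib]
    have h2 : ∀ p ∈ primesOne z, ∀ q ∈ primesOne z,
        |partialSum indS (x / (p * q)) - S / (p * q)| ≤
          C / Real.log x * S * ((1 + Real.log p) / p * (1 / q) + 1 / p * ((1 + Real.log q) / q)) := by
      intro p hp q hq
      obtain ⟨hp1', hpz⟩ := hp1 p hp
      obtain ⟨hq1', hqz⟩ := hp1 q hq
      have h3 := hvar x (p * q) hx1 (one_le_mul_of_one_le_of_one_le hp1' hq1') (by
        rw [← hzx]
        calc ((p : ℝ) * q) ^ 2 ≤ (z * z) ^ 2 := by gcongr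
          _ = z ^ 4 := by ring)
      refine h3.trans ?_
      have h4 : C * ((1 + Real.log (p * q)) / (p * q)) / Real.log x * S =
          C / Real.log x * S * ((1 + Real.log (p * q)) / (p * q)) := by ring
      -- Since `1 + log (p q) ≤ (1 + log p) + (1 + log q)`, the double sum of errors separates into
      -- `E H + H E`.
      have h5 : (1 + Real.log p) / p * (1 / q) + 1 / p * ((1 + Real.log q) / q) =
          (2 + Real.log p + Real.log q) / ((p : ℝ) * q) := by
        field_simp; ring
      rw [h4, h5, Real.log_mul (by linarith) (by linarith)]
      refine mul_le_mul_of_nonneg_left (div_le_div_of_nonneg_right ?_ (by positivity))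
        (by positivity)
      linarith
    refine (Finset.abs_sum_le_sum_abs _ _).trans ?_
    have h3 : ∑ p ∈ primesOne z, |∑ q ∈ (primesOne z).erase p,
        (partialSum indS (x / (p * q)) - S / (p * q))| ≤
        ∑ p ∈ primesOne z, ∑ q ∈ primesOne z,
          C / Real.log x * S *
            ((1 + Real.log p) / p * (1 / q) + 1 / p * ((1 + Real.log q) / q)) := by
      refine Finset.sum_le_sum fun p hp => (Finset.abs_sum_le_sum_abs _ _).trans ?_
      refine (Finset.sum_le_sum_of_subset_of_nonneg (Finset.erase_subset _ _)
        fun _ _ _ => abs_nonneg _).trans (Finset.sum_le_sum fun q hq => h2 p hp q hq)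
    have h4 : ∑ p ∈ primesOne z, ∑ q ∈ primesOne z, C / Real.log x * S *
          ((1 + Real.log p) / p * (1 / q) + 1 / p * ((1 + Real.log q) / q)) =
        C / Real.log x * S * (E * H + H * E) := by
      rw [hE, hH, invSum, Finset.sum_mul_sum, Finset.sum_mul_sum, ← Finset.sum_add_distrib,
        Finset.mul_sum]
      refine Finset.sum_congr rfl fun p _ => ?_
      rw [← Finset.sum_add_distrib, Finset.mul_sum]
    rw [h4] at h3
    refine h3.trans ?_
    have h5 : C / Real.log x * E ≤ 2 * C * (1 + 2 * C') := by
      rw [div_mul_eq_mul_div, div_le_iff₀ hlx]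
      have := mul_le_mul_of_nonneg_left hEle hC.le
      linarith
    have h6 := mul_le_mul_of_nonneg_right h5 (mul_nonneg hS0 hH0)
    linarith
  have hdiag : ∑ p ∈ primesOne z, ∑ q ∈ (primesOne z).erase p, S / (p * q) =
      S * (H ^ 2 - ∑ p ∈ primesOne z, 1 / (p : ℝ) * (1 / p)) := by
    have h1 : H ^ 2 = ∑ p ∈ primesOne z, ∑ q ∈ primesOne z, 1 / (p : ℝ) * (1 / q) := by
      rw [hH, invSum, sq, Finset.sum_mul_sum]
    rw [h1, ← Finset.sum_sub_distrib, Finset.mul_sum]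
    refine Finset.sum_congr rfl fun p hp => ?_
    rw [← Finset.add_sum_erase _ _ hp, add_sub_cancel_left, Finset.mul_sum]
    exact Finset.sum_congr rfl fun q _ => by rw [one_div_mul_one_div, mul_one_div]
  have hsq0 : 0 ≤ ∑ p ∈ primesOne z, 1 / (p : ℝ) * (1 / p) :=
    Finset.sum_nonneg fun p _ => by positivity
  have hsqle : ∑ p ∈ primesOne z, 1 / (p : ℝ) * (1 / p) ≤ H := by
    refine Finset.sum_le_sum fun p hp => mul_le_of_le_one_right (by positivity) ?_
    exact div_le_one_of_le₀ (hp1 p hp).1 p.cast_nonneg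
  have hB : 0 ≤ C * (1 + 2 * C') * S := by positivity
  have hBH : 0 ≤ C * (1 + 2 * C') * S * H := by positivity
  have hSH : 0 ≤ S * H := by positivity
  rw [sum_indS_mul_omegaUpTo_sq, sum_indS_mul_omegaUpTo]
  refine ⟨hfirst.trans (by linarith), ?_⟩
  rw [hdiag] at hsecond
  have h7 := mul_le_mul_of_nonneg_left hsqle hS0
  have h8 := mul_nonneg hS0 hsq0
  rw [abs_le] at hfirst hsecond ⊢
  constructor <;> linarith [hfirst.1, hfirst.2, hsecond.1, hsecond.2]

/-! ### From truncated moments to the averages of `omegaOne` -/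

theorem sum_sumTwoSqUpTo (x : ℝ) (F : ℕ → ℝ) :
    ∑ n ∈ sumTwoSqUpTo x, F n = ∑ n ∈ Finset.Ioc 0 ⌊x⌋₊, indS n * F n := by
  rw [sumTwoSqUpTo, Finset.sum_filter]
  refine Finset.sum_congr rfl fun n hn => ?_
  have hn0 : n ≠ 0 := by have := (Finset.mem_Icc.1 hn).1; omega
  rw [indS_apply]
  by_cases h : n ∈ sumTwoSq
  · rw [if_pos h, if_pos ⟨hn0, h⟩, one_mul]
  · rw [if_neg h, if_neg fun h' => h h'.2, zero_mul]

theorem card_sumTwoSqUpTo (x : ℝ) : ((sumTwoSqUpTo x).card : ℝ) = partialSum indS x := by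
  have := sum_sumTwoSqUpTo x fun _ => 1
  simpa [partialSum] using this

/-- The terms `8 * (H + C) + 16` come from `(ω + 4)² = ω² + 8 ω + 16` with a first moment at most `H
+ C`. The factorisation of `H² - l²/4` loses one factor `l`. -/
theorem abs_sub_sq_le_of_abs_sub_half_le {B C H l v : ℝ} (hB : 0 ≤ B) (hC : 0 ≤ C) (hl : 1 ≤ l)
    (hH : 0 ≤ H) (hHl : |H - l / 2| ≤ B) (hv : |v - H ^ 2| ≤ C * (1 + H) + 8 * (H + C) + 16) :
    |v - 1 / 4 * l ^ 2| ≤ (C * (2 + B) + 8 * (1 + B + C) + 16 + B + B ^ 2) * l := by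
  have hHle := (abs_le.1 hHl).2
  have hBl : B ≤ B * l := le_mul_of_one_le_right hB hl
  have hCl : C ≤ C * l := le_mul_of_one_le_right hC hl
  have h1 : |H ^ 2 - 1 / 4 * l ^ 2| ≤ (B + B ^ 2) * l := by
    have h2 : H ^ 2 - 1 / 4 * l ^ 2 = (H - l / 2) * (H + l / 2) := by ring
    rw [h2, abs_mul, abs_of_nonneg (by linarith : 0 ≤ H + l / 2)]
    refine (mul_le_mul hHl (by linarith : H + l / 2 ≤ l + B * l) (by linarith) hB).trans_eq ?_
    ring
  have h2 : C * (1 + H) ≤ C * ((2 + B) * l) := mul_le_mul_of_nonneg_left (by linarith) hC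
  have h3 : v - 1 / 4 * l ^ 2 = (v - H ^ 2) + (H ^ 2 - 1 / 4 * l ^ 2) := by ring
  rw [h3]
  refine (abs_add_le _ _).trans ?_
  linarith

theorem exists_omegaOne_moments :
    ∃ C x₀ : ℝ, 0 < C ∧ ∀ x : ℝ, x₀ ≤ x → 1 ≤ Real.log (Real.log x) ∧
      |(1 / ((sumTwoSqUpTo x).card : ℝ)) * ∑ n ∈ sumTwoSqUpTo x, (omegaOne n : ℝ) -
        1 / 2 * Real.log (Real.log x)| ≤ C ∧
      |(1 / ((sumTwoSqUpTo x).card : ℝ)) * ∑ n ∈ sumTwoSqUpTo x, (omegaOne n : ℝ) ^ 2 -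
        1 / 4 * Real.log (Real.log x) ^ 2| ≤ C * Real.log (Real.log x) := by
  obtain ⟨C₁, x₁, hC₁, hmom⟩ := exists_omegaUpTo_moments
  obtain ⟨C₂, hC₂, hH⟩ := exists_abs_sum_inv_primesOne_sub_le
  have hl4 : 0 < Real.log 4 := Real.log_pos (by norm_num)
  set B := C₂ + Real.log 4 with hB
  have hB0 : 0 < B := by positivity
  set C₃ := C₁ + 4 + B with hC₃
  set C₄ := C₁ * (2 + B) + 8 * (1 + B + C₁) + 16 + B + B ^ 2 with hC₄
  refine ⟨C₃ + C₄, max x₁ (max 16 (Real.exp (Real.exp 1))), by positivity, fun x hx => ?_⟩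
  have hx1 : x₁ ≤ x := (le_max_left _ _).trans hx
  have hx16 : 16 ≤ x := (le_max_left _ _).trans ((le_max_right _ _).trans hx)
  have hxe : Real.exp (Real.exp 1) ≤ x := (le_max_right _ _).trans ((le_max_right _ _).trans hx)
  have hx0 : 0 < x := by linarith
  have hl1 : Real.exp 1 ≤ Real.log x := by rwa [Real.le_log_iff_exp_le hx0]
  have hlx : 0 < Real.log x := (Real.exp_pos 1).trans_le hl1
  set ll := Real.log (Real.log x) with hll
  have hll1 : 1 ≤ ll := by rwa [hll, Real.le_log_iff_exp_le hlx]
  refine ⟨hll1, ?_⟩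
  -- This truncation changes `log log x` only by `log 4`; `x ≥ 16` guarantees `z ≥ 2`.
  set z := x ^ (1 / 4 : ℝ) with hz
  have hzx : z ^ 4 = x := by
    rw [hz, ← Real.rpow_natCast, ← Real.rpow_mul hx0.le]; norm_num
  have hz0 : 0 ≤ z := by positivity
  have hz2 : 2 ≤ z := by
    refine le_of_pow_le_pow_left₀ (n := 4) (by norm_num) hz0 ?_
    rw [hzx]; linarith
  have hlz : Real.log z = Real.log x / 4 := by
    rw [hz, Real.log_rpow hx0]; ring
  have hllz : Real.log (Real.log z) = ll - Real.log 4 := by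
    rw [hlz, Real.log_div hlx.ne' (by norm_num)]
  set S := partialSum indS x with hS
  set H := invSum z with hHdef
  have hH0 : 0 ≤ H := invSum_nonneg z
  have hHll : |H - ll / 2| ≤ B := by
    have h1 := hH z hz2
    rw [hllz] at h1
    rw [hB]
    change |H - (ll - Real.log 4) / 2| ≤ C₂ at h1
    rw [abs_le] at h1 ⊢
    constructor <;> linarith [h1.1, h1.2]
  have hS0 : 0 < S := by
    have h1 : indS 1 = 1 := isMultiplicative_indS.map_one
    have h2 : indS 1 ≤ S := Finset.single_le_sum (f := fun n => indS n)
      (fun n _ => indS_nonneg n) (by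
        rw [Finset.mem_Ioc]
        exact ⟨one_pos, (Nat.one_le_floor_iff x).2 (by linarith)⟩)
    linarith
  obtain ⟨hm1, hm2⟩ := hmom x z hx1 (by linarith) hzx
  rw [card_sumTwoSqUpTo, sum_sumTwoSqUpTo, sum_sumTwoSqUpTo, ← hS]
  set W₁ := ∑ n ∈ Finset.Ioc 0 ⌊x⌋₊, indS n * omegaUpTo z n with hW₁
  set W₂ := ∑ n ∈ Finset.Ioc 0 ⌊x⌋₊, indS n * omegaUpTo z n ^ 2 with hW₂
  set V₁ := ∑ n ∈ Finset.Ioc 0 ⌊x⌋₊, indS n * (omegaOne n : ℝ) with hV₁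
  set V₂ := ∑ n ∈ Finset.Ioc 0 ⌊x⌋₊, indS n * (omegaOne n : ℝ) ^ 2 with hV₂
  have hbd := fun n hn => omegaOne_bounds (x := x) (by linarith : 1 < z) hzx (n := n) hn
  have hom0 : ∀ n, 0 ≤ omegaUpTo z n := fun n =>
    Finset.sum_nonneg fun p _ => by split_ifs <;> norm_num
  have h1 : W₁ ≤ V₁ := Finset.sum_le_sum fun n hn =>
    mul_le_mul_of_nonneg_left (hbd n hn).1 (indS_nonneg n)
  have h2 : V₁ ≤ W₁ + 4 * S := by
    rw [hW₁, hS, partialSum, Finset.mul_sum, ← Finset.sum_add_distrib]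
    refine Finset.sum_le_sum fun n hn => ?_
    have := mul_le_mul_of_nonneg_left (hbd n hn).2 (indS_nonneg n)
    linarith
  have h3 : W₂ ≤ V₂ := Finset.sum_le_sum fun n hn =>
    mul_le_mul_of_nonneg_left (pow_le_pow_left₀ (hom0 n) (hbd n hn).1 2) (indS_nonneg n)
  have h4 : V₂ ≤ W₂ + 8 * W₁ + 16 * S := by
    rw [hW₁, hW₂, hS, partialSum, Finset.mul_sum, Finset.mul_sum, ← Finset.sum_add_distrib,
      ← Finset.sum_add_distrib]
    refine Finset.sum_le_sum fun n hn => ?_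
    have h5 := pow_le_pow_left₀ ((hom0 n).trans (hbd n hn).1) (hbd n hn).2 2
    have := mul_le_mul_of_nonneg_left h5 (indS_nonneg n)
    nlinarith
  have hHle := abs_le.1 hHll
  have hHub : H ≤ (1 + B) * ll := by nlinarith [hHle.2]
  have hC₃0 : 0 ≤ C₃ := by positivity
  have hC₄0 : 0 ≤ C₄ := by positivity
  have hv1 : |1 / S * V₁ - H| ≤ C₁ + 4 := by
    have h5 : 1 / S * V₁ - H = (V₁ - S * H) / S := by field_simp
    rw [h5, abs_div, abs_of_pos hS0, div_le_iff₀ hS0]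
    rw [abs_le] at hm1 ⊢
    constructor <;> linarith [hm1.1, hm1.2]
  have hv2 : |1 / S * V₂ - H ^ 2| ≤ C₁ * (1 + H) + 8 * (H + C₁) + 16 := by
    have h5 : 1 / S * V₂ - H ^ 2 = (V₂ - S * H ^ 2) / S := by field_simp
    rw [h5, abs_div, abs_of_pos hS0, div_le_iff₀ hS0]
    have h6 : 0 ≤ S * H := by positivity
    have h7 : 0 ≤ S * C₁ := by positivity
    rw [abs_le] at hm1 hm2 ⊢
    constructor <;> linarith [hm1.1, hm1.2, hm2.1, hm2.2]
  constructor
  · rw [abs_le] at hv1 ⊢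
    constructor <;> linarith [hv1.1, hv1.2]
  · refine (abs_sub_sq_le_of_abs_sub_half_le hB0.le hC₁.le hll1 hH0 hHll hv2).trans ?_
    have h7 : 0 ≤ C₃ * ll := mul_nonneg hC₃0 (by linarith)
    rw [← hC₄]
    linarith

end TwoSquares

theorem proposition3p4 :
    ((fun x : ℝ =>
        (1 / ((sumTwoSqUpTo x).card : ℝ)) * ∑ n ∈ sumTwoSqUpTo x, (omegaOne n : ℝ)
          - (1 / 2) * Real.log (Real.log x))
      =O[atTop] fun x : ℝ => Real.log (Real.log (Real.log x))) ∧
    ((fun x : ℝ =>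
        (1 / ((sumTwoSqUpTo x).card : ℝ)) * ∑ n ∈ sumTwoSqUpTo x, (omegaOne n : ℝ) ^ 2
          - (1 / 4) * (Real.log (Real.log x)) ^ 2)
      =O[atTop] fun x : ℝ => Real.log (Real.log x) * Real.log (Real.log (Real.log x))) := by
  obtain ⟨C, x₀, hC, h⟩ := TwoSquares.exists_omegaOne_moments
  -- The bounds already hold without the triple logarithm, which is only needed to be eventually at
  -- least `1`.
  have hlll : ∀ᶠ x : ℝ in atTop, 1 ≤ Real.log (Real.log (Real.log x)) :=
    (Real.tendsto_log_atTop.comp (Real.tendsto_log_atTop.comp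
      Real.tendsto_log_atTop)).eventually_ge_atTop 1
  constructor
  · refine IsBigO.of_bound C ?_
    filter_upwards [hlll, eventually_ge_atTop x₀] with x hx hx₀
    obtain ⟨-, h1, -⟩ := h x hx₀
    rw [Real.norm_eq_abs, Real.norm_of_nonneg (by linarith)]
    exact h1.trans (le_mul_of_one_le_right hC.le hx)
  · refine IsBigO.of_bound C ?_
    filter_upwards [hlll, eventually_ge_atTop x₀] with x hx hx₀
    obtain ⟨hll, -, h2⟩ := h x hx₀
    rw [Real.norm_eq_abs, Real.norm_of_nonneg (mul_nonneg (by linarith) (by linarith)), ← mul_assoc]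
    exact h2.trans (le_mul_of_one_le_right (by positivity) hx)
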